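/- Let $k$ be a (commutative) field and let $\mathcal{A}$ be an essentially small additive category which is $k$-trivial, i.e. for all objects $x,y$ of $\mathcal{A}$ the abelian group $\mathcal{A}(x,y)$ is finite, of order invertible in $k$. Let $\mathbf{Rep}(\mathcal{A})$ be the category of additive functors from $\mathcal{A}$ to abelian groups, and $\mathcal{F}(\mathcal{A};k)$ the category of all functors from $\mathcal{A}$ to $k$-vector spaces. An object of $\mathbf{Rep}(\mathcal{A})$ is called finite if it is noetherian and artinian; $\ell(A)$ denotes the length of such an object. For $A$ in $\mathbf{Rep}(\mathcal{A})$, let $k[A]\in\mathcal{F}(\mathcal{A};k)$ be the functor $a\mapsto k[A(a)]$ (the $k$-vector space with basis $A(a)$), and let $Q_A$ be the cokernel of the morphism $\bigoplus_{B\subsetneq A}k[B]\to k[A]$ induced by the inclusions of the proper subobjects $B$ of $A$; the group $\mathrm{Aut}(A)$ acts on $Q_A$. For a $k[\mathrm{Aut}(A)]$-module $M$, let $Q_{A,M}\in\mathcal{F}(\mathcal{A};k)$ be the functor $a\mapsto (M\otimes_k Q_A(a))_{\mathrm{Aut}(A)}$ (coinvariants of the diagonal action). Let $A$ and $B$ be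 finite objects of $\mathbf{Rep}(\mathcal{A})$ such that $\ell(A)\le\ell(B)$, let $M$ be a $k[\mathrm{Aut}(A)]$-module and $N$ a $k[\mathrm{Aut}(B)]$-module. 1. If $A$ and $B$ are not isomorphic, then $\mathrm{Ext}^n_{\mathcal{F}(\mathcal{A};k)}(Q_{A,M},Q_{B,N})=0$ for every $n\ge 0$. 2. If $A=B$, the functor $Q_{A,-}$ from $k[\mathrm{Aut}(A)]$-modules to $\mathcal{F}(\mathcal{A};k)$ is exact, and the natural morphism $$\mathrm{Ext}^n_{k[\mathrm{Aut}(A)]}(M,N)\longrightarrow\mathrm{Ext}^n_{\mathcal{F}(\mathcal{A};k)}(Q_{A,M},Q_{A,N})$$ which it induces is an isomorphism for every $n\ge 0$. -/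

import Mathlib

open CategoryTheory CategoryTheory.Limits

universe w v u

noncomputable section

namespace GenericRep

variable {𝒜 : Type u} [Category.{v} 𝒜] [Preadditive 𝒜]

/-! ### `k`-trivial additive categories -/

/-- A preadditive category is `k`-trivial if each of its groups of morphisms is finite, of order
invertible in `k`. -/
structure IsKTrivial (k : Type w) [Field k] (𝒜 : Type u) [Category.{v} 𝒜] [Preadditive 𝒜] :
    Prop where
  finite_hom (x y : 𝒜) : Finite (x ⟶ y)
  isUnit_card_hom (x y : 𝒜) : IsUnit ((Nat.card (x ⟶ y) : ℕ) : k)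

/-! ### Finite objects and length -/

/-- An object is finite (of finite length) if it is both noetherian and artinian. -/
structure IsFiniteObject {C : Type*} [Category* C] (X : C) : Prop where
  isArtinian : IsArtinianObject X
  isNoetherian : IsNoetherianObject X

/-- The length of an object: the supremum of the lengths `n` of chains `X₀ < X₁ < ⋯ < Xₙ` of
subobjects. -/
def objLength {C : Type*} [Category* C] (X : C) : WithBot ℕ∞ :=
  Order.krullDim (Subobject X)

/-! ### The two categories of functors -/

/-- The category of additive functors from `𝒜` to abelian groups. -/
abbrev AddRep (𝒜 : Type u) [Category.{v} 𝒜] [Preadditive 𝒜] :=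
  𝒜 ⥤+ AddCommGrpCat.{w}

/-- The category of all functors from `𝒜` to `k`-vector spaces. -/
abbrev FunRep (k : Type w) [Field k] (𝒜 : Type u) [Category.{v} 𝒜] :=
  𝒜 ⥤ ModuleCat.{w} k

variable (k : Type w) [Field k]

/-- The linearisation functor `A ↦ k[A]`. -/
def linearization : AddRep.{w} 𝒜 ⥤ FunRep k 𝒜 :=
  AdditiveFunctor.forget 𝒜 AddCommGrpCat.{w} ⋙
    (Functor.whiskeringRight 𝒜 _ _).obj (forget AddCommGrpCat.{w} ⋙ ModuleCat.free k)

/-! ### The functor `Q_A` -/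

variable (A : AddRep.{w} 𝒜)

/-- The value at `a` of the image of the canonical morphism `⨁_{B ⊊ A} k[B] ⟶ k[A]`. -/
def properPart (a : 𝒜) : Submodule k (((linearization k).obj A).obj a) :=
  ⨆ B : {B : Subobject A // B ≠ ⊤},
    LinearMap.range (((linearization k).map B.1.arrow).app a).hom

variable {A} in
lemma properPart_le_comap_map {a b : 𝒜} (f : a ⟶ b) :
    properPart k A a ≤
      (properPart k A b).comap (((linearization k).obj A).map f).hom := by
  refine iSup_le fun B => ?_
  rintro _ ⟨x, rfl⟩
  have h := congr($(((linearization k).map B.1.arrow).naturality f) x)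
  exact (le_iSup (fun B : {B : Subobject A // B ≠ ⊤} =>
    LinearMap.range (((linearization k).map B.1.arrow).app b).hom) B) ⟨_, h⟩

variable {A} in
lemma properPart_le_comap_aut (g : Aut A) (a : 𝒜) :
    properPart k A a ≤
      (properPart k A a).comap (((linearization k).map g.hom).app a).hom := by
  refine iSup_le fun B => ?_
  rintro _ ⟨x, rfl⟩
  have hg : IsIso g.hom := Iso.isIso_hom (show A ≅ A from g)
  let C : Subobject A := Subobject.mk (B.1.arrow ≫ g.hom)
  have hC : C ≠ ⊤ := by
    intro h
    have h1 : IsIso (B.1.arrow ≫ g.hom) := (Subobject.isIso_iff_mk_eq_top _).2 h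
    have h2 : IsIso B.1.arrow := IsIso.of_isIso_comp_right _ g.hom
    exact B.2 ((Subobject.isIso_arrow_iff_eq_top B.1).1 h2)
  refine (le_iSup (fun B : {B : Subobject A // B ≠ ⊤} =>
    LinearMap.range (((linearization k).map B.1.arrow).app a).hom) ⟨C, hC⟩) ?_
  refine ⟨(((linearization k).map
    (Subobject.underlyingIso (B.1.arrow ≫ g.hom)).inv).app a).hom x, ?_⟩
  have e : (linearization k).map (Subobject.underlyingIso (B.1.arrow ≫ g.hom)).inv ≫
      (linearization k).map C.arrow =
      (linearization k).map B.1.arrow ≫ (linearization k).map g.hom := by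
    rw [← Functor.map_comp, ← Functor.map_comp, Subobject.underlyingIso_arrow]
  exact congr(($(e).app a).hom x)

/-- The action of `Aut A` on the quotient `Q_A(a)` of `k[A(a)]`. -/
def quotientAction (a : 𝒜) :
    Representation k (Aut A) (((linearization k).obj A).obj a ⧸ properPart k A a) where
  toFun g := Submodule.mapQ _ _ (((linearization k).map g.hom).app a).hom
    (properPart_le_comap_aut k g a)
  map_one' := by
    refine Submodule.linearMap_qext _ (LinearMap.ext fun x => ?_)
    exact congrArg (properPart k A a).mkQ
      congr((($((linearization k).map_id A)).app a).hom x)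
  map_mul' g h := by
    refine Submodule.linearMap_qext _ (LinearMap.ext fun x => ?_)
    exact congrArg (properPart k A a).mkQ
      congr((($((linearization k).map_comp h.hom g.hom)).app a).hom x)

/-- The functor `Q_A`, the cokernel of the canonical morphism `⨁_{B ⊊ A} k[B] ⟶ k[A]`, together
with the action of `Aut A`: a functor from `𝒜` to `k`-linear representations of `Aut A`. -/
def QA : 𝒜 ⥤ Rep.{w} k (Aut A) where
  obj a := Rep.of (quotientAction k A a)
  map {a b} f := Rep.ofHom
    { toLinearMap := Submodule.mapQ _ _ (((linearization k).obj A).map f).hom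
        (properPart_le_comap_map k f)
      isIntertwining' := fun g => by
        refine Submodule.linearMap_qext _ (LinearMap.ext fun x => ?_)
        exact congrArg (properPart k A b).mkQ
          congr($(((linearization k).map g.hom).naturality f) x).symm }
  map_id a := by
    ext x
    exact congrArg (properPart k A a).mkQ congr($(((linearization k).obj A).map_id a) x)
  map_comp {a b c} f g := by
    ext x
    exact congrArg (properPart k A c).mkQ congr($(((linearization k).obj A).map_comp f g) x)

open scoped MonoidAlgebra

/-- The functor `Q_{A,-}`, sending a `k[Aut A]`-module `M` to the functor
`a ↦ (M ⊗ Q_A(a))_{Aut A}`, the coinvariants of the diagonal action of `Aut A`. -/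
def QFunctor : ModuleCat.{w} k[Aut A] ⥤ FunRep k 𝒜 :=
  Rep.ofModuleMonoidAlgebra ⋙ Rep.coinvariantsTensor k (Aut A) ⋙
    (Functor.whiskeringLeft 𝒜 _ _).obj (QA k A)

instance : (Rep.ofModuleMonoidAlgebra (k := k) (G := Aut A)).Additive where

instance : (QFunctor k A).Additive where
  map_add {M N f g} := by
    ext a : 2
    refine Rep.coinvariantsTensor_hom_ext ?_
    refine LinearMap.ext fun m => LinearMap.ext fun q => ?_
    exact (congrArg (Representation.Coinvariants.mk
      ((Rep.ofModuleMonoidAlgebra.obj N).ρ.tprod ((QA k A).obj a).ρ))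
      (TensorProduct.add_tmul ((Rep.ofModuleMonoidAlgebra.map f).hom m)
        ((Rep.ofModuleMonoidAlgebra.map g).hom m) q)).trans (map_add _ _ _)

/-! ### `Ext` groups

Mathlib's `Ext` groups, taken in a universe in which they always exist. -/

universe v₁ v₂ u₁ u₂

/-- The group `Extⁿ(X, Y)` in an abelian category. -/
abbrev ExtGroup {C : Type u₁} [Category.{v₁} C] [Abelian C] (X Y : C) (n : ℕ) :
    Type (max u₁ v₁) :=
  letI : HasExt.{max u₁ v₁} C := HasExt.standard C
  Abelian.Ext.{max u₁ v₁} X Y n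

/-- The morphism `Extⁿ(X, Y) ⟶ Extⁿ(F X, F Y)` induced by an exact functor `F`. -/
abbrev mapExtGroup {C : Type u₁} [Category.{v₁} C] [Abelian C]
    {D : Type u₂} [Category.{v₂} D] [Abelian D] (F : C ⥤ D) [F.Additive]
    [PreservesFiniteLimits F] [PreservesFiniteColimits F] (X Y : C) (n : ℕ) :
    ExtGroup X Y n →+ ExtGroup (F.obj X) (F.obj Y) n :=
  letI : HasExt.{max u₁ v₁} C := HasExt.standard C
  letI : HasExt.{max u₂ v₂} D := HasExt.standard D
  F.mapExtAddHom X Y n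

end GenericRep

end

/-!
If `B` takes finite values, `Q_{B, V}(a)` is the space of `Aut B`-equivariant functions with values
in `V` on the generating elements of `B(a)`; so `Q_{B, -}` is exact.

If `L` is a free `k[Aut A]`-module on `I`, then `Q_{A, L}` is the quotient of `k[A × I]` by the
linearisation of its non generating elements, and both have vanishing `Ext` groups in positive
degree into `Q_{B, J}` with `J` injective. For `k[X]`, where `X` behaves fibrewise like an additive
functor, take the Čech nerve of a cover of `X` by representable functors. It becomes contractible
after applying `Hom(-, Q_{B, J})`, by a mean of functions with values in `J`: a limit along a
filter, which exists because `J` is injective. For the non generating elements, take the Čech nerve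
of the disjoint union of the proper subobjects of `A`: it admits no nonzero morphism to `Q_{B, J}`,
since such a morphism makes `B` a subquotient of a proper subobject of `A`, whereas
`ℓ(A) ≤ ℓ(B) < ∞`. The same argument shows that `Q_{A, M} ⟶ Q_{B, N}` vanishes unless `A ≅ B` and
that `Q_{A, -}` is fully faithful. Dimension shifting does the rest.
-/

noncomputable section

namespace GenericRep

/-! ### Vanishing criteria for `Ext` -/

section Ext

universe t t' v₁ v₂ u₁ u₂

open Abelian

variable {C : Type u₁} [Category.{v₁} C] [Abelian C]

lemma shortExact_kernel {X Y : C} (f : X ⟶ Y) [Epi f] :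
    (ShortComplex.mk _ _ (kernel.condition f)).ShortExact where
  exact := ShortComplex.exact_kernel f

lemma shortExact_cokernel {X Y : C} (f : X ⟶ Y) [Mono f] :
    (ShortComplex.mk _ _ (cokernel.condition f)).ShortExact where
  exact := ShortComplex.exact_cokernel f

lemma comp_kernelLift_eq_zero {W X Y Z : C} {f : W ⟶ X} {g : X ⟶ Y} {h : Y ⟶ Z} (hfg : f ≫ g = 0)
    (hgh : g ≫ h = 0) : f ≫ kernel.lift h g hgh = 0 := by
  simpa [← cancel_mono (kernel.ι h)] using hfg

lemma exact_kernelLift {W X Y Z : C} {f : W ⟶ X} {g : X ⟶ Y} {h : Y ⟶ Z} {hfg : f ≫ g = 0}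
    (hgh : g ≫ h = 0) (ex : (ShortComplex.mk f g hfg).Exact) :
    (ShortComplex.mk f (kernel.lift h g hgh) (comp_kernelLift_eq_zero hfg hgh)).Exact := by
  let α : ShortComplex.mk f (kernel.lift h g hgh) (comp_kernelLift_eq_zero hfg hgh) ⟶
      ShortComplex.mk f g hfg := { τ₁ := 𝟙 _, τ₂ := 𝟙 _, τ₃ := kernel.ι h }
  have : Epi α.τ₁ := inferInstanceAs (Epi (𝟙 _))
  have : IsIso α.τ₂ := inferInstanceAs (IsIso (𝟙 _))
  have : Mono α.τ₃ := inferInstanceAs (Mono (kernel.ι h))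
  exact (ShortComplex.exact_iff_of_epi_of_isIso_of_mono α).2 ex

variable [HasExt.{t} C]

lemma subsingleton_ext_of_iso {X X' : C} (e : X ≅ X') {F : C} {n : ℕ}
    (h : Subsingleton (Ext X F n)) : Subsingleton (Ext X' F n) := by
  refine Function.Injective.subsingleton (β := Ext X F n)
    (f := fun x => (Ext.mk₀ e.hom).comp x (zero_add n)) (Function.LeftInverse.injective
      (g := fun x => (Ext.mk₀ e.inv).comp x (zero_add n)) fun x => ?_)
  dsimp only
  rw [← Ext.comp_assoc_of_second_deg_zero, Ext.mk₀_comp_mk₀, e.inv_hom_id, Ext.mk₀_id_comp]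

lemma subsingleton_ext_zero_iff (X F : C) :
    Subsingleton (Ext X F 0) ↔ ∀ f : X ⟶ F, f = 0 := by
  let e : Ext X F 0 ≃ (X ⟶ F) := Ext.homEquiv₀
  refine ⟨fun h f => e.symm.injective (Subsingleton.elim _ _), fun h => ?_⟩
  exact e.subsingleton_congr.2 (subsingleton_of_forall_eq 0 h)

section ShortExact

variable {S : ShortComplex C} (hS : S.ShortExact)

include hS

lemma subsingleton_ext_X₃ {F : C} {n : ℕ} (h₁ : Subsingleton (Ext S.X₁ F n))
    (h₂ : Subsingleton (Ext S.X₂ F (n + 1))) : Subsingleton (Ext S.X₃ F (n + 1)) := by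
  refine subsingleton_of_forall_eq 0 fun x => ?_
  obtain ⟨y, rfl⟩ := Ext.contravariant_sequence_exact₃ hS F x (Subsingleton.elim _ _)
    (add_comm 1 n)
  rw [Subsingleton.elim y 0, Ext.comp_zero]

lemma subsingleton_ext_one_X₃ {F : C} (extend : ∀ ψ : S.X₁ ⟶ F, ∃ φ : S.X₂ ⟶ F, S.f ≫ φ = ψ)
    (h₂ : Subsingleton (Ext S.X₂ F 1)) : Subsingleton (Ext S.X₃ F 1) := by
  refine subsingleton_of_forall_eq 0 fun x => ?_
  obtain ⟨y, rfl⟩ := Ext.contravariant_sequence_exact₃ hS F x (Subsingleton.elim _ _)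
    (add_comm 1 0)
  obtain ⟨ψ, rfl⟩ := Ext.homEquiv₀.symm.surjective y
  obtain ⟨φ, rfl⟩ := extend ψ
  have hφ : Ext.homEquiv₀.symm (S.f ≫ φ) = (Ext.mk₀ S.f).comp (Ext.mk₀ φ) (zero_add 0) :=
    (Ext.mk₀_comp_mk₀ _ _).symm
  rw [hφ, ← Ext.comp_assoc (a₁₂ := 1) (a₂₃ := 0) (a := 1) (h₁₂ := rfl) (h₂₃ := rfl)
    (h := rfl), hS.extClass_comp, Ext.zero_comp]

lemma subsingleton_ext_X₁_right {G : C} {n : ℕ} (h₃ : Subsingleton (Ext G S.X₃ n))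
    (h₂ : Subsingleton (Ext G S.X₂ (n + 1))) : Subsingleton (Ext G S.X₁ (n + 1)) := by
  refine subsingleton_of_forall_eq 0 fun x => ?_
  obtain ⟨y, rfl⟩ := Ext.covariant_sequence_exact₁ G hS x (Subsingleton.elim _ _) rfl
  rw [Subsingleton.elim y 0, Ext.zero_comp]

end ShortExact

lemma subsingleton_ext_of_resolution {F : C} (n : ℕ) {Z : C} {K : ℕ → C} (ε : K 0 ⟶ Z) [Epi ε]
    (d : ∀ p, K (p + 1) ⟶ K p) (hε : d 0 ≫ ε = 0) (hd : ∀ p, d (p + 1) ≫ d p = 0)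
    (exact_ε : (ShortComplex.mk _ _ hε).Exact) (exact_d : ∀ p, (ShortComplex.mk _ _ (hd p)).Exact)
    (exact_hom : ∀ p (φ : K (p + 1) ⟶ F), d (p + 1) ≫ φ = 0 → ∃ χ : K p ⟶ F, d p ≫ χ = φ)
    (acyclic : ∀ p i, p + i ≤ n → Subsingleton (Ext (K p) F (i + 1))) :
    Subsingleton (Ext Z F (n + 1)) := by
  have := exact_ε.epi_kernelLift
  have hd₁ := comp_kernelLift_eq_zero (hd 0) hε
  induction n generalizing Z K with
  | zero =>
    refine subsingleton_ext_one_X₃ (shortExact_kernel ε) (fun ψ => ?_) (acyclic 0 0 le_rfl)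
    obtain ⟨χ, hχ⟩ := exact_hom 0 (kernel.lift ε (d 0) hε ≫ ψ) (by
      rw [← Category.assoc, hd₁, zero_comp])
    exact ⟨χ, by simp [← cancel_epi (kernel.lift ε (d 0) hε), ← hχ]⟩
  | succ n ih =>
    have hK₁ := exact_kernelLift hε (exact_d 0)
    exact subsingleton_ext_X₃ (shortExact_kernel ε)
      (ih (kernel.lift ε (d 0) hε) (fun p => d (p + 1)) hd₁ (fun p => hd (p + 1)) hK₁
        (fun p => exact_d (p + 1)) (fun p => exact_hom (p + 1))
        (fun p i h => acyclic (p + 1) i (by lia))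
        hK₁.epi_kernelLift (comp_kernelLift_eq_zero (hd 1) hd₁))
      (acyclic 0 (n + 1) (by lia))

/-- Dimension shifting as in `Functor.mapExt_bijective_of_preservesInjectiveObjects`: the images of
the injective objects need only be acyclic against the image of `F`. -/
lemma mapExtAddHom_bijective_of_acyclic_injective {D : Type u₂} [Category.{v₂} D] [Abelian D]
    [HasExt.{t'} D] (F : C ⥤ D) [F.Additive] [PreservesFiniteLimits F] [PreservesFiniteColimits F]
    [F.Full] [F.Faithful] [EnoughInjectives C] (X : C)
    (acyclic : ∀ (J : C) [Injective J] (n : ℕ), Subsingleton (Ext (F.obj X) (F.obj J) (n + 1)))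
    (Y : C) (n : ℕ) : Function.Bijective (F.mapExtAddHom X Y n) := by
  induction n generalizing Y with
  | zero =>
    simpa [Ext.mapExactFunctor₀] using
      ⟨Functor.Faithful.map_injective, Functor.Full.map_surjective⟩
  | succ n ih =>
    let I : InjectivePresentation Y := Classical.arbitrary _
    have := I.injective
    let S := ShortComplex.mk _ _ (cokernel.condition I.f)
    have hS : S.ShortExact := shortExact_cokernel I.f
    have h₁ : Subsingleton (Ext X S.X₂ (n + 1)) := Ext.subsingleton_of_injective _ I.J _
    have h₂ : Subsingleton (Ext (F.obj X) (S.map F).X₂ (n + 1)) := acyclic I.J n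
    exact AddMonoidHom.bijective_of_surjective_of_bijective_of_right_exact _ _ _ _
      (F.mapExtAddHom X S.X₂ n) (F.mapExtAddHom X S.X₃ n) (F.mapExtAddHom X S.X₁ (n + 1))
      (by ext; simp [Ext.mapExactFunctor_comp, Ext.mapExactFunctor_mk₀]; rfl)
      (by ext; simp [Ext.mapExactFunctor_comp, Ext.mapExactFunctor_extClass]; rfl)
      ((ShortComplex.ab_exact_iff_function_exact _).mp
        (Ext.covariant_sequence_exact₃' X hS n (n + 1) rfl))
      ((ShortComplex.ab_exact_iff_function_exact _).mp
        (Ext.covariant_sequence_exact₃' (F.obj X) (hS.map F) n (n + 1) rfl))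
      (ih _).surjective (ih _)
      (fun x₁ ↦ Ext.covariant_sequence_exact₁ _ hS x₁ (Subsingleton.elim _ _) rfl)
      (fun y₁ ↦ Ext.covariant_sequence_exact₁ _ (hS.map F) y₁ (Subsingleton.elim _ _) rfl)

end Ext

/-! ### Length in modular lattices -/

section Order

lemma krullDim_ne_top_of_wellFounded {α : Type*} [Lattice α] [IsModularLattice α]
    [BoundedOrder α] [WellFoundedLT α] [WellFoundedGT α] : Order.krullDim α ≠ ⊤ := by
  obtain ⟨s, -, -, hs₀, hs₁⟩ :=
    LTSeries.exists_relSeries_covBy_and_head_eq_bot_and_last_eq_bot (RelSeries.singleton _ (⊥ : α))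
  refine ne_top_of_le_ne_top (b := ((s.length : ℕ∞) : WithBot ℕ∞))
    (fun h => ENat.natCast_ne_top s.length (WithBot.coe_injective h)) (iSup_le fun t => ?_)
  obtain ⟨t', i, -, ht₀, ht₁⟩ :=
    LTSeries.exists_relSeries_covBy_and_head_eq_bot_and_last_eq_bot t
  have hst : CompositionSeries.Equivalent s t' :=
    CompositionSeries.jordan_holder s t' (hs₀.trans ht₀.symm) (hs₁.trans ht₁.symm)
  have ht : t.length ≤ t'.length := by simpa using Fintype.card_le_of_embedding i
  exact_mod_cast ht.trans_eq hst.length_eq.symm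

variable {α β : Type*} [PartialOrder α] [BoundedOrder α] [PartialOrder β] [BoundedOrder β]
  {g : α → β}

lemma map_top_of_krullDim_le (hα : Order.krullDim α ≠ ⊤)
    (h : Order.krullDim β ≤ Order.krullDim α) (hg : StrictMono g) : g ⊤ = ⊤ := by
  rw [← Order.height_top_eq_krullDim] at hα
  rw [← Order.height_top_eq_krullDim, ← Order.height_top_eq_krullDim, WithBot.coe_le_coe] at h
  have hle : Order.height (⊤ : β) ≤ Order.height (g ⊤) :=
    h.trans (Order.height_le_height_apply_of_strictMono g hg ⊤)
  have htop : Order.height (⊤ : β) < ⊤ :=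
    h.trans_lt (lt_top_iff_ne_top.2 fun h => hα (congrArg WithBot.some h))
  by_contra hne
  exact hle.not_gt (Order.height_strictMono (lt_top_iff_ne_top.2 hne)
    ((Order.height_mono le_top).trans_lt htop))

lemma map_bot_of_krullDim_le (hα : Order.krullDim α ≠ ⊤)
    (h : Order.krullDim β ≤ Order.krullDim α) (hg : StrictMono g) : g ⊥ = ⊥ :=
  map_top_of_krullDim_le (α := αᵒᵈ) (β := βᵒᵈ) (g := OrderDual.toDual ∘ g ∘ OrderDual.ofDual)
    (by rwa [Order.krullDim_orderDual])
    (by rwa [Order.krullDim_orderDual, Order.krullDim_orderDual]) hg.dual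

end Order

/-! ### Subfunctors and subobjects -/

section Subfunctors

variable {𝒜 : Type u} [Category.{v} 𝒜] [Preadditive 𝒜]

lemma AddRep.map_add_apply (A : AddRep.{w} 𝒜) {a b : 𝒜} (f g : a ⟶ b) (x : A.obj.obj a) :
    A.obj.map (f + g) x = A.obj.map f x + A.obj.map g x := by simp

lemma AddRep.map_zero_apply (A : AddRep.{w} 𝒜) {a b : 𝒜} (x : A.obj.obj a) :
    A.obj.map (0 : a ⟶ b) x = 0 := by simp

section Biproduct

variable (A : AddRep.{w} 𝒜) [HasBinaryBiproducts 𝒜] {a c : 𝒜}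

lemma AddRep.exists_biprod_lift (v : A.obj.obj a) (v' : A.obj.obj c) :
    ∃ t : A.obj.obj (a ⊞ c), A.obj.map biprod.fst t = v ∧ A.obj.map biprod.snd t = v' :=
  ⟨A.obj.map biprod.inl v + A.obj.map biprod.inr v', by
    simp [← Functor.map_comp_apply, -Functor.map_comp], by
    simp [← Functor.map_comp_apply, -Functor.map_comp]⟩

lemma AddRep.biprod_total_apply (t : A.obj.obj (a ⊞ c)) :
    A.obj.map biprod.inl (A.obj.map biprod.fst t) +
      A.obj.map biprod.inr (A.obj.map biprod.snd t) = t := by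
  rw [← Functor.map_comp_apply, ← Functor.map_comp_apply, ← AddRep.map_add_apply, biprod.total,
    Functor.map_id_apply]

end Biproduct

lemma AddRep.hom_ext_apply {A B : AddRep.{w} 𝒜} {φ ψ : A ⟶ B}
    (h : ∀ a (x : A.obj.obj a), φ.hom.app a x = ψ.hom.app a x) : φ = ψ := by
  refine ObjectProperty.hom_ext _ (NatTrans.ext (funext fun a => ?_))
  ext x
  exact h a x

lemma AddRep.isIso_of_bijective {A B : AddRep.{w} 𝒜} (φ : A ⟶ B)
    (h : ∀ a, Function.Bijective (φ.hom.app a)) : IsIso φ := by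
  have : ∀ a, IsIso (((AdditiveFunctor.forget 𝒜 AddCommGrpCat).map φ).app a) := fun a =>
    (ConcreteCategory.isIso_iff_bijective _).2 (h a)
  have : IsIso ((AdditiveFunctor.forget 𝒜 AddCommGrpCat).map φ) := NatIso.isIso_of_isIso_app _
  exact isIso_of_reflects_iso φ (AdditiveFunctor.forget 𝒜 AddCommGrpCat)

/-- An additive subfunctor of an additive functor. -/
@[ext]
structure SubRep (A : AddRep.{w} 𝒜) where
  carrier (a : 𝒜) : AddSubgroup (A.obj.obj a)
  map_mem {a b : 𝒜} (f : a ⟶ b) {x : A.obj.obj a} : x ∈ carrier a → A.obj.map f x ∈ carrier b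

namespace SubRep

variable {A B : AddRep.{w} 𝒜}

instance : PartialOrder (SubRep A) :=
  PartialOrder.lift carrier fun _ _ h => SubRep.ext h

instance : Lattice (SubRep A) where
  sup S T :=
    { carrier := fun a => S.carrier a ⊔ T.carrier a
      map_mem := fun {a b} f x hx => by
        obtain ⟨y, hy, z, hz, rfl⟩ := AddSubgroup.mem_sup.1 hx
        rw [map_add]
        exact AddSubgroup.add_mem_sup (S.map_mem f hy) (T.map_mem f hz) }
  inf S T :=
    { carrier := fun a => S.carrier a ⊓ T.carrier a
      map_mem := fun f _ hx => ⟨S.map_mem f hx.1, T.map_mem f hx.2⟩ }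
  le_sup_left _ _ := fun _ => le_sup_left
  le_sup_right _ _ := fun _ => le_sup_right
  sup_le _ _ _ h h' := fun a => sup_le (h a) (h' a)
  inf_le_left _ _ := fun _ => inf_le_left
  inf_le_right _ _ := fun _ => inf_le_right
  le_inf _ _ _ h h' := fun a => le_inf (h a) (h' a)

instance : BoundedOrder (SubRep A) where
  top := { carrier := fun _ => ⊤, map_mem := fun _ _ _ => trivial }
  bot := { carrier := fun _ => ⊥, map_mem := fun f x hx => by
            rw [AddSubgroup.mem_bot] at hx ⊢; rw [hx, map_zero] }
  le_top _ := fun _ => le_top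
  bot_le _ := fun _ => bot_le

instance : IsModularLattice (SubRep A) where
  sup_inf_le_assoc_of_le T _ h a := sup_inf_le_assoc_of_le (T.carrier a) (h a)

/-- The functor underlying an additive subfunctor. -/
def toFunctor (S : SubRep A) : 𝒜 ⥤ AddCommGrpCat.{w} where
  obj a := AddCommGrpCat.of (S.carrier a)
  map {a b} f := AddCommGrpCat.ofHom
    (((A.obj.map f).hom.comp (S.carrier a).subtype).codRestrict (S.carrier b)
      fun x => S.map_mem f x.2)
  map_id _ := AddCommGrpCat.hom_ext (AddMonoidHom.ext fun x =>
    Subtype.ext (A.obj.map_id_apply _ x.1))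
  map_comp f g := AddCommGrpCat.hom_ext (AddMonoidHom.ext fun x =>
    Subtype.ext (A.obj.map_comp_apply f g x.1))

instance (S : SubRep A) : S.toFunctor.Additive where
  map_add {_ _ f g} := AddCommGrpCat.hom_ext (AddMonoidHom.ext fun x =>
    Subtype.ext (AddRep.map_add_apply A f g x.1))

/-- An additive subfunctor as an additive functor. -/
def toRep (S : SubRep A) : AddRep.{w} 𝒜 :=
  AdditiveFunctor.of S.toFunctor

/-- The inclusion of an additive subfunctor. -/
def ι (S : SubRep A) : S.toRep ⟶ A :=
  ObjectProperty.homMk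
    { app := fun a => AddCommGrpCat.ofHom (S.carrier a).subtype
      naturality := fun _ _ _ => rfl }

instance (S : SubRep A) : Mono S.ι where
  right_cancellation _ _ e := AddRep.hom_ext_apply fun a x =>
    Subtype.ext congr(($e).hom.app a x)

/-- The kernel of a morphism. -/
def ker (φ : A ⟶ B) : SubRep A where
  carrier a := (φ.hom.app a).hom.ker
  map_mem f x hx := by
    rw [AddMonoidHom.mem_ker] at hx ⊢
    exact (NatTrans.naturality_apply φ.hom f x).trans ((congrArg _ hx).trans (map_zero _))

/-- The preimage of a subfunctor. -/
def comap (φ : A ⟶ B) (T : SubRep B) : SubRep A where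
  carrier a := (T.carrier a).comap (φ.hom.app a).hom
  map_mem f x hx := by
    rw [AddSubgroup.mem_comap] at hx ⊢
    exact (NatTrans.naturality_apply φ.hom f x).symm ▸ T.map_mem f hx

/-- The image of a subfunctor. -/
def map (φ : A ⟶ B) (S : SubRep A) : SubRep B where
  carrier a := (S.carrier a).map (φ.hom.app a).hom
  map_mem f x hx := by
    obtain ⟨y, hy, rfl⟩ := hx
    exact ⟨A.obj.map f y, S.map_mem f hy, NatTrans.naturality_apply φ.hom f y⟩

end SubRep

lemma AddRep.injective_of_mono {A B : AddRep.{w} 𝒜} (φ : A ⟶ B) [Mono φ] (a : 𝒜) :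
    Function.Injective (φ.hom.app a) := by
  refine (injective_iff_map_eq_zero (φ.hom.app a).hom).2 fun x hx => ?_
  have : (SubRep.ker φ).ι = 0 := by
    rw [← cancel_mono φ, zero_comp]
    exact AddRep.hom_ext_apply fun a x => x.2
  exact congr(($this).hom.app a (⟨x, hx⟩ : (SubRep.ker φ).carrier a))

namespace SubRep

variable {A B : AddRep.{w} 𝒜}

/-- The morphism to a subfunctor containing the image. -/
def lift (φ : A ⟶ B) (T : SubRep B) (h : ∀ a x, φ.hom.app a x ∈ T.carrier a) : A ⟶ T.toRep :=
  ObjectProperty.homMk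
    { app := fun a => AddCommGrpCat.ofHom ((φ.hom.app a).hom.codRestrict (T.carrier a) (h a))
      naturality := fun _ _ f => AddCommGrpCat.hom_ext (AddMonoidHom.ext fun x =>
        Subtype.ext (NatTrans.naturality_apply φ.hom f x)) }

lemma lift_ι (φ : A ⟶ B) (T : SubRep B) (h : ∀ a x, φ.hom.app a x ∈ T.carrier a) :
    lift φ T h ≫ T.ι = φ := rfl

/-- Subobjects of an additive functor are additive subfunctors. -/
def subobjectEquiv (A : AddRep.{w} 𝒜) : SubRep A ≃o Subobject A :=
  RelIso.ofSurjective
    (OrderEmbedding.ofMapLEIff (fun S : SubRep A => Subobject.mk S.ι) fun S T => by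
      constructor
      · intro h a x hx
        have h1 := Subobject.ofMkLEMk_comp (f := S.ι) (g := T.ι) h
        have h2 := congr(($h1).hom.app a (⟨x, hx⟩ : S.carrier a))
        have h3 : ((Subobject.ofMkLEMk S.ι T.ι h).hom.app a ⟨x, hx⟩ : T.carrier a).1 = x := h2
        exact h3 ▸ ((Subobject.ofMkLEMk S.ι T.ι h).hom.app a ⟨x, hx⟩ : T.carrier a).2
      · intro h
        exact Subobject.mk_le_mk_of_comm (lift S.ι T fun a x => h a x.2) (lift_ι _ _ _))
    fun X => by
      refine ⟨map X.arrow ⊤, ?_⟩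
      let l := lift X.arrow (map X.arrow ⊤) fun a x => ⟨x, trivial, rfl⟩
      have hl : IsIso l := AddRep.isIso_of_bijective _ fun a =>
        ⟨fun x y h => AddRep.injective_of_mono X.arrow a congr(($h).1), fun y => by
          obtain ⟨x, -, hx⟩ := y.2
          exact ⟨x, Subtype.ext hx⟩⟩
      conv_rhs => rw [← Subobject.mk_arrow X]
      refine (Subobject.mk_eq_mk_of_comm _ _ (asIso l).symm ?_)
      exact (Iso.inv_comp_eq (asIso l)).2 rfl

instance [IsNoetherianObject A] : WellFoundedGT (SubRep A) :=
  (subobjectEquiv A).toOrderEmbedding.wellFoundedGT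

instance [IsArtinianObject A] : WellFoundedLT (SubRep A) :=
  (subobjectEquiv A).toOrderEmbedding.wellFoundedLT

lemma objLength_eq : objLength A = Order.krullDim (SubRep A) :=
  (Order.krullDim_eq_of_orderIso (subobjectEquiv A)).symm

lemma krullDim_ne_top_of_isFiniteObject (hA : IsFiniteObject A) :
    Order.krullDim (SubRep A) ≠ ⊤ :=
  have := hA.isArtinian
  have := hA.isNoetherian
  krullDim_ne_top_of_wellFounded

lemma strictMono_map_comap (D : SubRep A) (φ : D.toRep ⟶ B)
    (hφ : ∀ a, Function.Surjective (φ.hom.app a)) :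
    StrictMono fun T : SubRep B => map D.ι (comap φ T) := by
  have hle (S T : SubRep B) : map D.ι (comap φ S) ≤ map D.ι (comap φ T) ↔ S ≤ T := by
    constructor
    · intro hST a y hy
      obtain ⟨x, rfl⟩ := hφ a y
      obtain ⟨z, hz, hzx⟩ := hST a ⟨x, hy, rfl⟩
      rw [← AddRep.injective_of_mono D.ι a hzx]
      exact hz
    · rintro hST a _ ⟨x, hx, rfl⟩
      exact ⟨x, hST a hx, rfl⟩
  exact (OrderEmbedding.ofMapLEIff _ hle).strictMono

lemma eq_top_and_isIso_of_surjective_of_objLength_le (hB : IsFiniteObject B)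
    (h : objLength A ≤ objLength B) (D : SubRep A) (φ : D.toRep ⟶ B)
    (hφ : ∀ a, Function.Surjective (φ.hom.app a)) : D = ⊤ ∧ IsIso φ := by
  have hfin := krullDim_ne_top_of_isFiniteObject hB
  have hmono := strictMono_map_comap D φ hφ
  rw [objLength_eq, objLength_eq] at h
  have map_top := map_top_of_krullDim_le hfin h hmono
  have map_bot := map_bot_of_krullDim_le hfin h hmono
  refine ⟨top_le_iff.1 (map_top.ge.trans ?_), AddRep.isIso_of_bijective _ fun a => ⟨?_, hφ a⟩⟩
  · rintro a _ ⟨x, -, rfl⟩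
    exact x.2
  · refine (injective_iff_map_eq_zero (φ.hom.app a).hom).2 fun x hx => ?_
    have hDx : D.ι.hom.app a x ∈ (map D.ι (comap φ ⊥)).carrier a := ⟨x, hx, rfl⟩
    rw [map_bot] at hDx
    exact AddRep.injective_of_mono D.ι a ((AddSubgroup.mem_bot.1 hDx).trans (map_zero _).symm)

end SubRep

/-! ### Generating elements -/

variable {A B : AddRep.{w} 𝒜}

/-- An element `v` of `A(a)` is generating if every element of `A` is the image of `v` under some
morphism, equivalently if `v` lies in no proper subobject of `A`: as `𝒜` is additive, the images of
`v` form a subfunctor (see `SubRep.span`). -/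
def IsGenerating {a : 𝒜} (v : A.obj.obj a) : Prop :=
  ∀ ⦃b : 𝒜⦄ (y : A.obj.obj b), ∃ f : a ⟶ b, A.obj.map f v = y

/-- The subfunctor generated by an element. -/
def SubRep.span {a : 𝒜} (v : A.obj.obj a) : SubRep A where
  carrier b :=
    { carrier := Set.range fun f : a ⟶ b => A.obj.map f v
      add_mem' := by
        rintro _ _ ⟨f, rfl⟩ ⟨g, rfl⟩
        exact ⟨f + g, AddRep.map_add_apply A f g v⟩
      zero_mem' := ⟨0, AddRep.map_zero_apply A v⟩
      neg_mem' := by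
        rintro _ ⟨f, rfl⟩
        exact ⟨-f, by simp⟩ }
  map_mem := by
    rintro b c g _ ⟨f, rfl⟩
    exact ⟨f ≫ g, A.obj.map_comp_apply f g v⟩

lemma SubRep.mem_span {a b : 𝒜} (v : A.obj.obj a) (y : A.obj.obj b) :
    y ∈ (SubRep.span v).carrier b ↔ ∃ f : a ⟶ b, A.obj.map f v = y := Iff.rfl

lemma SubRep.self_mem_span {a : 𝒜} (v : A.obj.obj a) : v ∈ (SubRep.span v).carrier a :=
  ⟨𝟙 a, A.obj.map_id_apply a v⟩

lemma SubRep.span_le {a : 𝒜} {v : A.obj.obj a} {S : SubRep A} :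
    SubRep.span v ≤ S ↔ v ∈ S.carrier a := by
  refine ⟨fun h => h a (self_mem_span v), ?_⟩
  rintro h b _ ⟨f, rfl⟩
  exact S.map_mem f h

lemma SubRep.span_eq_top_iff {a : 𝒜} (v : A.obj.obj a) : SubRep.span v = ⊤ ↔ IsGenerating v := by
  refine ⟨fun h b y => ?_, fun h => top_le_iff.1 fun b y _ => h y⟩
  exact (SubRep.mem_span v y).1 (h.ge b trivial)

lemma IsGenerating.of_iso {a : 𝒜} {v : A.obj.obj a} (φ : A ≅ B)
    (h : IsGenerating (φ.hom.hom.app a v)) : IsGenerating v := fun b y => by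
  obtain ⟨f, hf⟩ := h (φ.hom.hom.app b y)
  refine ⟨f, AddRep.injective_of_mono φ.hom b ?_⟩
  rw [NatTrans.naturality_apply, hf]

lemma IsGenerating.of_map {a b : 𝒜} {v : A.obj.obj a} (f : a ⟶ b)
    (h : IsGenerating (A.obj.map f v)) : IsGenerating v := fun c y => by
  obtain ⟨g, hg⟩ := h y
  exact ⟨f ≫ g, (A.obj.map_comp_apply f g v).trans hg⟩

open scoped ZeroObject in
lemma exists_isGenerating [HasFiniteBiproducts 𝒜] (A : AddRep.{w} 𝒜) [IsNoetherianObject A] :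
    ∃ (x : 𝒜) (ξ : A.obj.obj x), IsGenerating ξ := by
  have : HasBinaryBiproducts 𝒜 := hasBinaryBiproducts_of_finite_biproducts 𝒜
  have : HasZeroObject 𝒜 := hasZeroObject_of_hasFiniteBiproducts 𝒜
  let s : Set (SubRep A) := {S | ∃ (x : 𝒜) (ξ : A.obj.obj x), S = SubRep.span ξ}
  obtain ⟨_, ⟨x, ξ, rfl⟩, hmax⟩ := WellFounded.has_min (wellFounded_gt (α := SubRep A)) s
    ⟨_, ⟨(0 : 𝒜), 0, rfl⟩⟩
  refine ⟨x, ξ, (SubRep.span_eq_top_iff ξ).1 (top_le_iff.1 fun b y _ => ?_)⟩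
  obtain ⟨ζ, hξ, hy⟩ := A.exists_biprod_lift ξ y
  have hle : SubRep.span ξ ≤ SubRep.span ζ := SubRep.span_le.2 ⟨_, hξ⟩
  rw [hle.eq_of_not_lt (hmax _ ⟨_, ζ, rfl⟩)]
  exact ⟨_, hy⟩

lemma IsGenerating.finite {x a : 𝒜} [Finite (x ⟶ a)] {ξ : A.obj.obj x} (h : IsGenerating ξ) :
    Finite (A.obj.obj a) :=
  Finite.of_surjective (fun f : x ⟶ a => A.obj.map f ξ) fun y => h y

lemma IsGenerating.hom_ext {x : 𝒜} {ξ : A.obj.obj x} (h : IsGenerating ξ) {φ ψ : A ⟶ B}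
    (e : φ.hom.app x ξ = ψ.hom.app x ξ) : φ = ψ := by
  refine AddRep.hom_ext_apply fun a y => ?_
  obtain ⟨f, rfl⟩ := h y
  rw [NatTrans.naturality_apply, NatTrans.naturality_apply, e]

lemma IsGenerating.exists_hom {x : 𝒜} {ξ : A.obj.obj x} (h : IsGenerating ξ) (β : B.obj.obj x)
    (hβ : ∀ ⦃c : 𝒜⦄ (r : x ⟶ c), A.obj.map r ξ = 0 → B.obj.map r β = 0) :
    ∃ φ : A ⟶ B, φ.hom.app x ξ = β := by
  have hwd : ∀ ⦃c : 𝒜⦄ (f g : x ⟶ c), A.obj.map f ξ = A.obj.map g ξ →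
      B.obj.map f β = B.obj.map g β := fun c f g e => by
    have := hβ (f - g) (by simp [e])
    rwa [← sub_eq_zero, ← show B.obj.map (f - g) β = B.obj.map f β - B.obj.map g β by simp]
  choose F hF using @h
  let φ (a : 𝒜) : A.obj.obj a →+ B.obj.obj a :=
    AddMonoidHom.mk' (fun y => B.obj.map (F y) β) fun y z => by
      rw [← AddRep.map_add_apply]
      exact hwd _ _ (by rw [AddRep.map_add_apply, hF, hF, hF])
  refine ⟨ObjectProperty.homMk
    { app := fun a => AddCommGrpCat.ofHom (φ a)
      naturality := fun a b f => ?_ }, ?_⟩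
  · ext y
    change B.obj.map (F (A.obj.map f y)) β = B.obj.map f (B.obj.map (F y) β)
    rw [← Functor.map_comp_apply]
    exact hwd _ _ (by rw [Functor.map_comp_apply, hF, hF])
  · change B.obj.map (F ξ) β = β
    rw [hwd (F ξ) (𝟙 x) (by rw [hF, Functor.map_id_apply]), Functor.map_id_apply]

/-! ### The proper part of `k[A]` -/

variable (k : Type w) [Field k]

lemma range_map_arrow_le_supported (X : Subobject A) (hX : X ≠ ⊤) (a : 𝒜) :
    LinearMap.range (((linearization k).map X.arrow).app a).hom ≤
      Finsupp.supported k k {v : A.obj.obj a | ¬ IsGenerating v} := by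
  refine LinearMap.range_le_iff_comap.2 (Submodule.eq_top_iff'.2 fun x => ?_)
  refine Finsupp.induction_linear (motive := fun x => x ∈ Submodule.comap
    (Finsupp.lmapDomain k k (X.arrow.hom.app a))
    (Finsupp.supported k k {v : A.obj.obj a | ¬ IsGenerating v})) x (Submodule.zero_mem _)
    (fun _ _ => Submodule.add_mem _) fun x r => ?_
  rw [Submodule.mem_comap, Finsupp.lmapDomain_apply, Finsupp.mapDomain_single]
  refine Finsupp.single_mem_supported k r fun h => hX ?_
  refine (Subobject.isIso_arrow_iff_eq_top X).1 (AddRep.isIso_of_bijective _ fun b =>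
    ⟨AddRep.injective_of_mono _ b, fun y => ?_⟩)
  obtain ⟨f, rfl⟩ := h y
  exact ⟨_, NatTrans.naturality_apply X.arrow.hom f x⟩

lemma single_mem_properPart {a : 𝒜} {v : A.obj.obj a} (hv : ¬ IsGenerating v) :
    Finsupp.single v (1 : k) ∈ properPart k A a := by
  let S := SubRep.span v
  let X := SubRep.subobjectEquiv A S
  have hX : X ≠ ⊤ := fun h => hv ((SubRep.span_eq_top_iff v).1
    ((SubRep.subobjectEquiv A).injective (h.trans (map_top _).symm)))
  refine (le_iSup (fun X : {X : Subobject A // X ≠ ⊤} =>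
    LinearMap.range (((linearization k).map X.1.arrow).app a).hom) ⟨X, hX⟩) ?_
  let v' : S.toRep.obj.obj a := (⟨v, SubRep.self_mem_span v⟩ : S.carrier a)
  have hv' : X.arrow.hom.app a ((Subobject.underlyingIso S.ι).inv.hom.app a v') = v :=
    congr(($(Subobject.underlyingIso_arrow S.ι)).hom.app a v')
  exact ⟨Finsupp.single ((Subobject.underlyingIso S.ι).inv.hom.app a v') 1,
    Finsupp.mapDomain_single.trans (congrArg (fun y => Finsupp.single y (1 : k)) hv')⟩

lemma properPart_eq_supported (A : AddRep.{w} 𝒜) (a : 𝒜) :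
    properPart k A a = Finsupp.supported k k {v : A.obj.obj a | ¬ IsGenerating v} := by
  refine le_antisymm (iSup_le fun X => range_map_arrow_le_supported k X.1 X.2 a) ?_
  rw [Finsupp.supported_eq_span_single]
  refine Submodule.span_le.2 ?_
  rintro _ ⟨v, hv, rfl⟩
  exact single_mem_properPart k hv

end Subfunctors

/-! ### Coefficients of the elements of `Q_{A, V}` -/

section Coefficients

variable {𝒜 : Type u} [Category.{v} 𝒜] [Preadditive 𝒜] {k : Type w} [Field k]
  {A : AddRep.{w} 𝒜}

instance (a : 𝒜) : MulAction (Aut A) (A.obj.obj a) where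
  smul g v := g.hom.hom.app a v
  one_smul _ := rfl
  mul_smul _ _ _ := rfl

lemma map_aut_smul {a b : 𝒜} (f : a ⟶ b) (g : Aut A) (v : A.obj.obj a) :
    A.obj.map f (g • v) = g • A.obj.map f v :=
  (NatTrans.naturality_apply g.hom.hom f v).symm

namespace IsGenerating

lemma aut_smul {a : 𝒜} {v : A.obj.obj a} (h : IsGenerating v) (g : Aut A) :
    IsGenerating (g • v) := fun b y => by
  obtain ⟨f, hf⟩ := h (g⁻¹ • y)
  exact ⟨f, by rw [map_aut_smul, hf, smul_inv_smul]⟩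

lemma of_aut_smul {a : 𝒜} {v : A.obj.obj a} {g : Aut A} (h : IsGenerating (g • v)) :
    IsGenerating v := by
  simpa only [inv_smul_smul] using h.aut_smul g⁻¹

lemma aut_smul_injective {a : 𝒜} {v : A.obj.obj a} (h : IsGenerating v) :
    Function.Injective fun g : Aut A => g • v :=
  fun _ _ e => Aut.ext (h.hom_ext e)

end IsGenerating

namespace QA

/-- The projection from `k[A(a)]` to `Q_A(a)`. -/
def proj (k : Type w) [Field k] (A : AddRep.{w} 𝒜) (a : 𝒜) :
    (A.obj.obj a →₀ k) →ₗ[k] (QA k A).obj a :=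
  (properPart k A a).mkQ

lemma proj_surjective (a : 𝒜) : Function.Surjective (proj k A a) :=
  (properPart k A a).mkQ_surjective

lemma proj_single_eq_zero {a : 𝒜} {v : A.obj.obj a} (hv : ¬ IsGenerating v) (r : k) :
    proj k A a (Finsupp.single v r) = 0 := by
  refine (Submodule.Quotient.mk_eq_zero _).2 ?_
  rw [properPart_eq_supported]
  exact Finsupp.single_mem_supported k r hv

lemma ρ_proj_single {a : 𝒜} (g : Aut A) (v : A.obj.obj a) (r : k) :
    ((QA k A).obj a).ρ g (proj k A a (Finsupp.single v r)) =
      proj k A a (Finsupp.single (g • v) r) :=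
  congrArg (properPart k A a).mkQ Finsupp.mapDomain_single

/-- The linear map out of `Q_A(a)` with prescribed values on the classes of the generating
elements. -/
def desc {a : 𝒜} {X : Type*} [AddCommGroup X] [Module k X] (φ : A.obj.obj a → X)
    (hφ : ∀ v, ¬ IsGenerating v → φ v = 0) : (QA k A).obj a →ₗ[k] X :=
  (properPart k A a).liftQ (Finsupp.linearCombination k φ) (by
    rw [properPart_eq_supported]
    intro x hx
    refine LinearMap.mem_ker.2 ((Finsupp.linearCombination_apply k x).trans ?_)
    refine Finset.sum_eq_zero fun v hv => ?_
    exact (congrArg (_ • ·) (hφ v (hx hv))).trans (smul_zero _))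

lemma desc_proj_single {a : 𝒜} {X : Type*} [AddCommGroup X] [Module k X]
    (φ : A.obj.obj a → X) (hφ : ∀ v, ¬ IsGenerating v → φ v = 0) (v : A.obj.obj a) (r : k) :
    desc φ hφ (proj k A a (Finsupp.single v r)) = r • φ v :=
  Finsupp.linearCombination_single k r v

end QA

/-- The functor `V ↦ Q_{A, V}`, for `V` a representation of `Aut A` rather than a
`k[Aut A]`-module. -/
def QRepFunctor (k : Type w) [Field k] (A : AddRep.{w} 𝒜) : Rep.{w} k (Aut A) ⥤ FunRep k 𝒜 :=
  Rep.coinvariantsTensor k (Aut A) ⋙ (Functor.whiskeringLeft 𝒜 _ _).obj (QA k A)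

/-- The functor `Q_{A, V}`, for `V` a representation of `Aut A`. -/
abbrev QRep (V : Rep.{w} k (Aut A)) : FunRep k 𝒜 :=
  (QRepFunctor k A).obj V

namespace QRep

/-- The map `m ↦ [m ⊗ v]` from `V` to `Q_{A, V}(a)`, for `v` in `A(a)`. -/
def mk (V : Rep.{w} k (Aut A)) {a : 𝒜} (v : A.obj.obj a) : V →ₗ[k] (QRep V).obj a :=
  (Rep.coinvariantsTensorMk V ((QA k A).obj a)).flip (QA.proj k A a (Finsupp.single v 1))

variable {V W : Rep.{w} k (Aut A)} {a b : 𝒜}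

lemma mk_eq_zero {v : A.obj.obj a} (hv : ¬ IsGenerating v) (m : V) : mk V v m = 0 :=
  (congrArg (fun q => Rep.coinvariantsTensorMk V ((QA k A).obj a) m q)
    (QA.proj_single_eq_zero hv 1)).trans (map_zero _)

lemma mk_aut_smul (g : Aut A) (v : A.obj.obj a) (m : V) : mk V (g • v) (V.ρ g m) = mk V v m := by
  have h := Representation.Coinvariants.mk_self_apply (V.ρ.tprod ((QA k A).obj a).ρ) g
    (m ⊗ₜ[k] QA.proj k A a (Finsupp.single v 1))
  refine Eq.trans (congrArg (Representation.Coinvariants.mk (V.ρ.tprod ((QA k A).obj a).ρ)) ?_) h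
  refine Eq.trans ?_ (TensorProduct.map_tmul _ _ _ _).symm
  exact congrArg _ (QA.ρ_proj_single g v 1).symm

lemma map_mk (f : a ⟶ b) (v : A.obj.obj a) (m : V) :
    (QRep V).map f (mk V v m) = mk V (A.obj.map f v) m :=
  congrArg (fun q => Rep.coinvariantsTensorMk V ((QA k A).obj b) m q)
    (congrArg (properPart k A b).mkQ Finsupp.mapDomain_single)

lemma map_app_mk (φ : V ⟶ W) (v : A.obj.obj a) (m : V) :
    ((QRepFunctor k A).map φ).app a (mk V v m) = mk W v (φ.hom m) := rfl

@[elab_as_elim]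
lemma induction {P : (QRep V).obj a → Prop} (zero : P 0) (add : ∀ x y, P x → P y → P (x + y))
    (mk : ∀ (v : A.obj.obj a) (m : V), IsGenerating v → P (mk V v m)) (x : (QRep V).obj a) :
    P x := by
  obtain ⟨t, rfl⟩ := Representation.Coinvariants.mk_surjective
    (V.ρ.tprod ((QA k A).obj a).ρ) x
  induction t using TensorProduct.induction_on with
  | zero => rw [map_zero]; exact zero
  | add x y hx hy => rw [map_add]; exact add _ _ hx hy
  | tmul m q =>
    obtain ⟨q, rfl⟩ := QA.proj_surjective a q
    induction q using Finsupp.induction_linear with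
    | zero => rw [map_zero, TensorProduct.tmul_zero, map_zero]; exact zero
    | add x y hx hy => rw [map_add, TensorProduct.tmul_add, map_add]; exact add _ _ hx hy
    | single v r =>
      have h : m ⊗ₜ[k] QA.proj k A a (Finsupp.single v r) =
          (r • m) ⊗ₜ[k] QA.proj k A a (Finsupp.single v 1) := by
        rw [TensorProduct.smul_tmul, ← map_smul, Finsupp.smul_single, smul_eq_mul, mul_one]
      rw [h]
      by_cases hv : IsGenerating v
      · exact mk v (r • m) hv
      · exact (mk_eq_zero hv (r • m) : QRep.mk V v (r • m) = 0) ▸ zero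

open scoped Classical in
/-- The action on `V` of the automorphism of `A` sending `v` to `β`, if `β` is generating and there
is such an automorphism (it is then unique), and `0` otherwise. -/
def autCoeff (V : Rep.{w} k (Aut A)) (β v : A.obj.obj a) : V →ₗ[k] V :=
  if h : IsGenerating β ∧ ∃ g : Aut A, g • v = β then V.ρ h.2.choose else 0

lemma autCoeff_smul_self {v : A.obj.obj a} (hv : IsGenerating v) (g : Aut A) :
    autCoeff V (g • v) v = V.ρ g := by
  have h : IsGenerating (g • v) ∧ ∃ g' : Aut A, g' • v = g • v := ⟨hv.aut_smul g, g, rfl⟩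
  rw [autCoeff, dif_pos h, hv.aut_smul_injective h.2.choose_spec]

lemma autCoeff_of_forall_ne {β v : A.obj.obj a} (h : ∀ g : Aut A, g • v ≠ β) :
    autCoeff V β v = 0 :=
  dif_neg fun h' => h _ h'.2.choose_spec

lemma autCoeff_of_not_isGenerating {β v : A.obj.obj a} (h : ¬ IsGenerating v) :
    autCoeff V β v = 0 :=
  dif_neg fun ⟨hβ, _, hg⟩ => h (hg ▸ hβ).of_aut_smul

lemma autCoeff_smul_left (g : Aut A) (β v : A.obj.obj a) :
    autCoeff V (g • β) v = V.ρ g * autCoeff V β v := by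
  by_cases hv : IsGenerating v
  · by_cases h : ∃ g' : Aut A, g' • v = β
    · obtain ⟨g', rfl⟩ := h
      rw [← mul_smul, autCoeff_smul_self hv, autCoeff_smul_self hv, map_mul]
    · push Not at h
      rw [autCoeff_of_forall_ne h, mul_zero, autCoeff_of_forall_ne]
      exact fun g' hg' => h (g⁻¹ * g') (by rw [mul_smul, hg', inv_smul_smul])
  · rw [autCoeff_of_not_isGenerating hv, autCoeff_of_not_isGenerating hv, mul_zero]

lemma autCoeff_smul_right (g : Aut A) (β v : A.obj.obj a) :
    autCoeff V β (g • v) * V.ρ g = autCoeff V β v := by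
  by_cases hv : IsGenerating v
  · by_cases h : ∃ g' : Aut A, g' • g • v = β
    · obtain ⟨g', rfl⟩ := h
      rw [autCoeff_smul_self (hv.aut_smul g), ← map_mul, ← mul_smul, autCoeff_smul_self hv]
    · push Not at h
      rw [autCoeff_of_forall_ne h, zero_mul, autCoeff_of_forall_ne]
      exact fun g' hg' => h (g' * g⁻¹) (by rw [mul_smul, inv_smul_smul, hg'])
  · rw [autCoeff_of_not_isGenerating hv, autCoeff_of_not_isGenerating (mt .of_aut_smul hv),
      zero_mul]

lemma autCoeff_naturality (φ : V ⟶ W) (β v : A.obj.obj a) (m : V) :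
    autCoeff W β v (φ.hom m) = φ.hom (autCoeff V β v m) := by
  by_cases h : IsGenerating β ∧ ∃ g : Aut A, g • v = β
  · rw [autCoeff, dif_pos h, autCoeff, dif_pos h]
    exact (Rep.hom_comm_apply φ _ m).symm
  · rw [autCoeff, dif_neg h, autCoeff, dif_neg h]
    exact (map_zero _).symm

open scoped Classical in
lemma autCoeff_map [Fintype (A.obj.obj a)] (f : a ⟶ b) {β : A.obj.obj b} (hβ : IsGenerating β)
    (v : A.obj.obj a) :
    autCoeff V β (A.obj.map f v) = ∑ γ with A.obj.map f γ = β, autCoeff V γ v := by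
  by_cases h : ∃ g : Aut A, g • A.obj.map f v = β
  · obtain ⟨g, rfl⟩ := h
    have hfv : IsGenerating (A.obj.map f v) := hβ.of_aut_smul
    have hgv : g • v ∈ ({γ | A.obj.map f γ = g • A.obj.map f v} : Finset _) := by
      rw [Finset.mem_filter_univ, map_aut_smul]
    rw [Finset.sum_eq_single_of_mem _ hgv, autCoeff_smul_self hfv,
      autCoeff_smul_self (hfv.of_map f)]
    intro γ hγ hne
    rw [Finset.mem_filter_univ] at hγ
    refine autCoeff_of_forall_ne ?_
    rintro g' rfl
    rw [map_aut_smul] at hγ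
    exact hne (congrArg (· • v) (hfv.aut_smul_injective hγ))
  · push Not at h
    rw [autCoeff_of_forall_ne h]
    refine (Finset.sum_eq_zero fun γ hγ => autCoeff_of_forall_ne ?_).symm
    rintro g rfl
    exact h g (by rw [← map_aut_smul, (Finset.mem_filter_univ _).1 hγ])

/-- The coefficient of an element of `Q_{A, V}(a)` at an element `β` of `A(a)`. -/
def coeff (V : Rep.{w} k (Aut A)) (β : A.obj.obj a) : (QRep V).obj a →ₗ[k] V :=
  Representation.Coinvariants.lift (V.ρ.tprod ((QA k A).obj a).ρ)
    (TensorProduct.lift (LinearMap.flip (QA.desc (autCoeff V β)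
      fun _ => autCoeff_of_not_isGenerating)))
    (fun g => by
      refine TensorProduct.ext' fun m q => ?_
      obtain ⟨q, rfl⟩ := QA.proj_surjective a q
      rw [LinearMap.comp_apply, Representation.tprod_apply, TensorProduct.map_tmul,
        TensorProduct.lift.tmul, TensorProduct.lift.tmul, LinearMap.flip_apply,
        LinearMap.flip_apply]
      induction q using Finsupp.induction_linear with
      | zero => simp only [map_zero, LinearMap.zero_apply]
      | add x y hx hy => simp only [map_add, LinearMap.add_apply, hx, hy]
      | single v r =>
        rw [QA.ρ_proj_single, QA.desc_proj_single, QA.desc_proj_single, LinearMap.smul_apply,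
          LinearMap.smul_apply, ← autCoeff_smul_right g β v, Module.End.mul_apply])

lemma coeff_mk (β v : A.obj.obj a) (m : V) : coeff V β (mk V v m) = autCoeff V β v m := by
  change QA.desc (autCoeff V β) (fun _ => autCoeff_of_not_isGenerating)
    (QA.proj k A a (Finsupp.single v 1)) m = _
  rw [QA.desc_proj_single, one_smul]

lemma coeff_mk_self {v : A.obj.obj a} (hv : IsGenerating v) (m : V) :
    coeff V v (mk V v m) = m := by
  have h := autCoeff_smul_self (V := V) hv 1
  rw [one_smul, map_one] at h
  rw [coeff_mk, h, Module.End.one_apply]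

lemma coeff_aut_smul (g : Aut A) (β : A.obj.obj a) (z : (QRep V).obj a) :
    coeff V (g • β) z = V.ρ g (coeff V β z) := by
  induction z using QRep.induction with
  | zero => simp only [map_zero]
  | add x y hx hy => rw [map_add, hx, hy, map_add, map_add]
  | mk v m => rw [coeff_mk, coeff_mk, autCoeff_smul_left, Module.End.mul_apply]

lemma coeff_map_app (φ : V ⟶ W) (β : A.obj.obj a) (z : (QRep V).obj a) :
    coeff W β (((QRepFunctor k A).map φ).app a z) = φ.hom (coeff V β z) := by
  induction z using QRep.induction with
  | zero => simp only [map_zero]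
  | add x y hx hy => rw [map_add, map_add, hx, hy, map_add, map_add]
  | mk v m => rw [map_app_mk, coeff_mk, coeff_mk, autCoeff_naturality]

open scoped Classical in
lemma coeff_map [Fintype (A.obj.obj a)] (f : a ⟶ b) {β : A.obj.obj b} (hβ : IsGenerating β)
    (z : (QRep V).obj a) :
    coeff V β ((QRep V).map f z) = ∑ γ with A.obj.map f γ = β, coeff V γ z := by
  induction z using QRep.induction with
  | zero => simp only [map_zero, Finset.sum_const_zero]
  | add x y hx hy => rw [map_add, map_add, hx, hy, ← Finset.sum_add_distrib]; simp only [map_add]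
  | mk v m =>
    rw [map_mk, coeff_mk, autCoeff_map f hβ, LinearMap.sum_apply]
    simp only [coeff_mk]

section Orbits

open MulAction (orbitRel)

/-- The orbits of `Aut A` on the generating elements of `A(a)`. -/
abbrev GenOrbit (A : AddRep.{w} 𝒜) (a : 𝒜) :=
  {o : orbitRel.Quotient (Aut A) (A.obj.obj a) // IsGenerating (Quotient.out o)}

lemma exists_genOrbit_of_isGenerating {v : A.obj.obj a} (hv : IsGenerating v) :
    ∃ (o : GenOrbit A a) (g : Aut A), v = g • o.1.out ∧
      ∀ o' : GenOrbit A a, (∃ g' : Aut A, g' • v = o'.1.out) → o' = o := by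
  let o : orbitRel.Quotient (Aut A) (A.obj.obj a) := Quotient.mk'' v
  obtain ⟨g, hg⟩ : ∃ g : Aut A, g • v = o.out :=
    MulAction.orbitRel_apply.1 (Quotient.exact (Quotient.out_eq o))
  refine ⟨⟨o, hg ▸ hv.aut_smul g⟩, g⁻¹, by rw [← hg, inv_smul_smul], ?_⟩
  rintro o' ⟨g', hg'⟩
  exact Subtype.ext ((Quotient.out_eq o'.1).symm.trans (Quotient.sound ⟨g', hg'⟩))

variable [Fintype (GenOrbit A a)]

lemma sum_mk_coeff (z : (QRep V).obj a) :
    ∑ o : GenOrbit A a, mk V o.1.out (coeff V o.1.out z) = z := by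
  induction z using QRep.induction with
  | zero => simp only [map_zero, Finset.sum_const_zero]
  | add x y hx hy =>
    conv_rhs => rw [← hx, ← hy]
    rw [← Finset.sum_add_distrib]
    simp only [map_add]
  | mk v m hv =>
    obtain ⟨o, g, rfl, ho⟩ := exists_genOrbit_of_isGenerating hv
    rw [Finset.sum_eq_single_of_mem o (Finset.mem_univ _)]
    · obtain ⟨m, rfl⟩ := V.ρ.apply_bijective g |>.surjective m
      rw [mk_aut_smul, coeff_mk_self o.2]
    · intro o' _ hne
      rw [coeff_mk, autCoeff_of_forall_ne fun g' hg' => hne (ho o' ⟨g', hg'⟩)]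
      exact map_zero _

lemma coeff_sum_mk (c : A.obj.obj a → V)
    (hc : ∀ (g : Aut A) β, IsGenerating β → c (g • β) = V.ρ g (c β)) {β : A.obj.obj a}
    (hβ : IsGenerating β) : coeff V β (∑ o : GenOrbit A a, mk V o.1.out (c o.1.out)) = c β := by
  obtain ⟨o, g, rfl, ho⟩ := exists_genOrbit_of_isGenerating hβ
  rw [map_sum, Finset.sum_eq_single_of_mem o (Finset.mem_univ _)]
  · rw [hc _ _ o.2, coeff_aut_smul, coeff_mk_self o.2]
  · intro o' _ hne
    rw [coeff_mk, autCoeff_of_forall_ne, LinearMap.zero_apply]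
    exact fun g' hg' => hne (ho o' ⟨g'⁻¹, by rw [← hg', inv_smul_smul]⟩)

end Orbits

lemma ext_coeff [Finite (A.obj.obj a)] {z z' : (QRep V).obj a}
    (h : ∀ β : A.obj.obj a, IsGenerating β → coeff V β z = coeff V β z') : z = z' := by
  have : Fintype (GenOrbit A a) := Fintype.ofFinite _
  rw [← sum_mk_coeff z, ← sum_mk_coeff z']
  exact Finset.sum_congr rfl fun o _ => by rw [h _ o.2]

lemma exists_coeff_eq [Finite (A.obj.obj a)] (c : A.obj.obj a → V)
    (hc : ∀ (g : Aut A) β, IsGenerating β → c (g • β) = V.ρ g (c β)) :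
    ∃ z : (QRep V).obj a, ∀ β, IsGenerating β → coeff V β z = c β := by
  have : Fintype (GenOrbit A a) := Fintype.ofFinite _
  exact ⟨_, fun _ => coeff_sum_mk c hc⟩

end QRep

end Coefficients

/-! ### Linearised functors to sets and covers by representable functors -/

section Linearization

variable {𝒜 : Type u} [Category.{v} 𝒜] {k : Type w} [Field k]

namespace FunRep

lemma exact_iff (S : ShortComplex (FunRep k 𝒜)) :
    S.Exact ↔ ∀ (a : 𝒜) (x : S.X₂.obj a), S.g.app a x = 0 → ∃ y, S.f.app a y = x := by
  have h : S.Exact ↔ ∀ a : 𝒜, (S.map ((evaluation 𝒜 (ModuleCat k)).obj a)).Exact := by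
    rw [S.exact_iff_isZero_homology, Functor.isZero_iff]
    refine forall_congr' fun a => ?_
    rw [ShortComplex.exact_iff_isZero_homology]
    exact (S.mapHomologyIso ((evaluation 𝒜 (ModuleCat k)).obj a)).isZero_iff.symm
  rw [h]
  exact forall_congr' fun a => ShortComplex.moduleCat_exact_iff _

lemma epi_iff {F G : FunRep k 𝒜} (φ : F ⟶ G) :
    Epi φ ↔ ∀ a, Function.Surjective (φ.app a) := by
  rw [NatTrans.epi_iff_epi_app]
  exact forall_congr' fun a => ModuleCat.epi_iff_surjective _

lemma mono_iff {F G : FunRep k 𝒜} (φ : F ⟶ G) :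
    Mono φ ↔ ∀ a, Function.Injective (φ.app a) := by
  rw [NatTrans.mono_iff_mono_app]
  exact forall_congr' fun a => ModuleCat.mono_iff_injective _

end FunRep

/-- The functor `a ↦ k[X(a)]` associated with a functor `X` to sets. -/
abbrev lin (k : Type w) [Field k] (X : 𝒜 ⥤ Type w) : FunRep k 𝒜 :=
  X ⋙ ModuleCat.free k

/-- The basis element of `k[X(a)]` associated with an element of `X(a)`. -/
def pt (k : Type w) [Field k] {X : 𝒜 ⥤ Type w} {a : 𝒜} (x : X.obj a) : (lin k X).obj a :=
  ModuleCat.freeMk x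

variable {X : 𝒜 ⥤ Type w} {F : FunRep k 𝒜}

lemma lin_map_pt {a b : 𝒜} (f : a ⟶ b) (x : X.obj a) :
    (lin k X).map f (pt k x) = pt k (X.map f x) :=
  ModuleCat.free_map_apply _ _

lemma lin_hom_ext {φ ψ : lin k X ⟶ F}
    (h : ∀ a (x : X.obj a), φ.app a (pt k x) = ψ.app a (pt k x)) : φ = ψ :=
  NatTrans.ext (funext fun a => ModuleCat.free_hom_ext (h a))

/-- The morphism out of `k[X]` induced by a natural transformation out of `X`. -/
def linDesc (φ : ∀ a, X.obj a → F.obj a)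
    (hφ : ∀ {a b} (f : a ⟶ b) (x : X.obj a), φ b (X.map f x) = F.map f (φ a x)) :
    lin k X ⟶ F where
  app a := ModuleCat.freeDesc (↾(φ a))
  naturality a b f := ModuleCat.free_hom_ext fun x => by
    refine (congrArg (ModuleCat.freeDesc (↾(φ b))) (lin_map_pt f x)).trans ?_
    refine (ModuleCat.freeDesc_apply _ _).trans ((hφ f x).trans ?_)
    exact congrArg (F.map f) (ModuleCat.freeDesc_apply (↾(φ a)) x).symm

lemma linDesc_pt (φ : ∀ a, X.obj a → F.obj a)
    (hφ : ∀ {a b} (f : a ⟶ b) (x : X.obj a), φ b (X.map f x) = F.map f (φ a x))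
    {a : 𝒜} (x : X.obj a) : (linDesc φ hφ).app a (pt k x) = φ a x :=
  ModuleCat.freeDesc_apply _ _

lemma app_pt_naturality (φ : lin k X ⟶ F) {a b : 𝒜} (f : a ⟶ b) (x : X.obj a) :
    φ.app b (pt k (X.map f x)) = F.map f (φ.app a (pt k x)) := by
  rw [← lin_map_pt, NatTrans.naturality_apply]

section Cover

variable [EssentiallySmall.{w} 𝒜]

/-- The object of `𝒜` corresponding to an object of its small model. -/
abbrev ofModel (s : SmallModel.{w} 𝒜) : 𝒜 :=
  (equivSmallModel 𝒜).inverse.obj s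

lemma exists_ofModel_iso (b : 𝒜) : ∃ s : SmallModel.{w} 𝒜, Nonempty (ofModel s ≅ b) :=
  ⟨_, ⟨((equivSmallModel.{w} 𝒜).unitIso.app b).symm⟩⟩

/-- The disjoint union, over the elements `v` of `X`, of the functors represented by the objects
supporting `v`. Restricting to a small model and shrinking the sets of morphisms keeps its values in
`Type w`. -/
def cover (X : 𝒜 ⥤ Type w) : 𝒜 ⥤ Type w where
  obj b := Σ i : (Σ s : SmallModel.{w} 𝒜, X.obj (ofModel s)), Shrink.{w} (ofModel i.1 ⟶ b)
  map f := ↾fun t => ⟨t.1, equivShrink _ ((equivShrink _).symm t.2 ≫ f)⟩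
  map_id b := ConcreteCategory.hom_ext _ _ fun t => congrArg (Sigma.mk t.1) <|
    show equivShrink _ ((equivShrink _).symm t.2 ≫ 𝟙 b) = t.2 by simp
  map_comp f g := ConcreteCategory.hom_ext _ _ fun t => congrArg (Sigma.mk t.1) <|
    show equivShrink _ ((equivShrink _).symm t.2 ≫ f ≫ g) =
      equivShrink _ ((equivShrink _).symm (equivShrink _ ((equivShrink _).symm t.2 ≫ f)) ≫ g) by
    simp

namespace cover

variable {b c : 𝒜} {s : SmallModel.{w} 𝒜}

/-- The element of the cover given by an element of `X` and a morphism. -/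
def mk (v : X.obj (ofModel s)) (g : ofModel s ⟶ b) : (cover X).obj b :=
  ⟨⟨s, v⟩, equivShrink _ g⟩

lemma exists_eq_mk (t : (cover X).obj b) :
    ∃ (s : SmallModel.{w} 𝒜) (v : X.obj (ofModel s)) (g : ofModel s ⟶ b), t = mk v g := by
  obtain ⟨⟨s, v⟩, g⟩ := t
  exact ⟨s, v, (equivShrink _).symm g,
    Sigma.ext rfl (heq_of_eq (Equiv.apply_symm_apply _ _).symm)⟩

lemma map_mk (v : X.obj (ofModel s)) (g : ofModel s ⟶ b) (f : b ⟶ c) :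
    (cover X).map f (mk v g) = mk v (g ≫ f) :=
  congrArg (fun h => mk v (h ≫ f)) (Equiv.symm_apply_apply _ g)

lemma mk_injective (v : X.obj (ofModel s)) : Function.Injective (mk v (b := b)) :=
  fun _ _ h => (equivShrink _).injective (eq_of_heq (Sigma.mk.inj h).2)

lemma exists_eq_mk_of_map_eq {e : 𝒜} {t : (cover X).obj b} {t' : (cover X).obj c}
    {f : b ⟶ e} {f' : c ⟶ e} (h : (cover X).map f t = (cover X).map f' t') :
    ∃ (s : SmallModel.{w} 𝒜) (v : X.obj (ofModel s)) (g : ofModel s ⟶ b) (g' : ofModel s ⟶ c),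
      t = mk v g ∧ t' = mk v g' := by
  obtain ⟨s, v, g, rfl⟩ := exists_eq_mk t
  obtain ⟨s', v', g', rfl⟩ := exists_eq_mk t'
  rw [map_mk, map_mk] at h
  cases (Sigma.mk.inj h).1
  exact ⟨s, v, g, g', rfl, rfl⟩

/-- The projection from the cover, which sends a morphism indexed by `v` to the image of `v`. -/
def π (X : 𝒜 ⥤ Type w) : cover X ⟶ X where
  app b := ↾fun t => X.map ((equivShrink _).symm t.2) t.1.2
  naturality b c f := by
    ext t
    obtain ⟨s, v, g, rfl⟩ := exists_eq_mk t
    change X.map ((equivShrink _).symm (equivShrink _ ((equivShrink _).symm (equivShrink _ g) ≫ f)))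
      v = X.map f (X.map ((equivShrink _).symm (equivShrink _ g)) v)
    simp only [Equiv.symm_apply_apply, Functor.map_comp_apply]

lemma π_mk (v : X.obj (ofModel s)) (g : ofModel s ⟶ b) : (π X).app b (mk v g) = X.map g v :=
  congrArg (fun g => X.map g v) (Equiv.symm_apply_apply _ g)

lemma π_surjective (b : 𝒜) : Function.Surjective ((π X).app b) := fun y => by
  obtain ⟨s, ⟨e⟩⟩ := exists_ofModel_iso.{w} b
  exact ⟨mk (X.map e.inv y) e.hom, by
    rw [π_mk, ← Functor.map_comp_apply, e.inv_hom_id, Functor.map_id_apply]⟩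

instance : Projective (lin k (cover X)) where
  factors {E F} φ q hq := by
    choose z hz using fun i : (Σ s : SmallModel.{w} 𝒜, X.obj (ofModel s)) =>
      (FunRep.epi_iff q).1 hq _ (φ.app (ofModel i.1) (pt k (mk i.2 (𝟙 _))))
    let ψ (b : 𝒜) (t : (cover X).obj b) : E.obj b := E.map ((equivShrink _).symm t.2) (z t.1)
    have hψ {s : SmallModel.{w} 𝒜} (v : X.obj (ofModel s)) {b : 𝒜} (g : ofModel s ⟶ b) :
        ψ b (mk v g) = E.map g (z ⟨s, v⟩) :=
      congrArg (fun g => E.map g (z ⟨s, v⟩)) (Equiv.symm_apply_apply _ g)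
    refine ⟨linDesc ψ fun {a b} f t => ?_, lin_hom_ext fun b t => ?_⟩
    · obtain ⟨s, v, g, rfl⟩ := exists_eq_mk t
      rw [map_mk, hψ, hψ, Functor.map_comp_apply]
    · obtain ⟨s, v, g, rfl⟩ := exists_eq_mk t
      rw [NatTrans.comp_app_apply, linDesc_pt, hψ, NatTrans.naturality_apply, hz ⟨s, v⟩,
        ← app_pt_naturality, map_mk, Category.id_comp]

end cover

end Cover

/-! ### Fibrewise additive functors to sets -/

variable [Preadditive 𝒜]

/-- Two elements lie in the same component of `X` if they have the same images under zero
morphisms. -/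
def SameComponent (X : 𝒜 ⥤ Type w) {a c : 𝒜} (v : X.obj a) (y : X.obj c) : Prop :=
  ∀ e : 𝒜, X.map (0 : a ⟶ e) v = X.map (0 : c ⟶ e) y

namespace SameComponent

lemma map {a c : 𝒜} (v : X.obj a) (f : a ⟶ c) : SameComponent X v (X.map f v) := fun e => by
  rw [← Functor.map_comp_apply, comp_zero]

variable {a b c : 𝒜} {v : X.obj a} {y : X.obj b} {z : X.obj c}

lemma symm (h : SameComponent X v y) : SameComponent X y v := fun e => (h e).symm

lemma trans (h : SameComponent X v y) (h' : SameComponent X y z) : SameComponent X v z :=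
  fun e => (h e).trans (h' e)

end SameComponent

variable [HasFiniteBiproducts 𝒜]

attribute [local instance] hasBinaryBiproducts_of_finite_biproducts

/-- A functor to sets is fibrewise additive if it is a disjoint union of functors preserving finite
products: a pair of elements of the same component comes from a unique element at the biproduct. -/
structure IsFiberAdditive (X : 𝒜 ⥤ Type w) : Prop where
  exists_lift {a c : 𝒜} (v : X.obj a) (y : X.obj c) (h : SameComponent X v y) :
    ∃ t : X.obj (a ⊞ c), X.map biprod.fst t = v ∧ X.map biprod.snd t = y
  ext {a c : 𝒜} {t t' : X.obj (a ⊞ c)} (h₁ : X.map biprod.fst t = X.map biprod.fst t')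
    (h₂ : X.map biprod.snd t = X.map biprod.snd t') : t = t'

lemma IsFiberAdditive.map_sub (hX : IsFiberAdditive X) {x a : 𝒜} (f g : x ⟶ a) (v : X.obj x)
    (h : X.map f v = X.map g v) : X.map (f - g) v = X.map (0 : x ⟶ a) v := by
  have hlift : X.map (biprod.lift f g) v = X.map (biprod.lift g g) v := by
    apply hX.ext <;> simp only [← Functor.map_comp_apply, biprod.lift_fst, biprod.lift_snd, h]
  have hdesc := congrArg (X.map (biprod.desc (𝟙 a) (-𝟙 a))) hlift
  rw [← Functor.map_comp_apply, ← Functor.map_comp_apply] at hdesc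
  simpa [biprod.lift_desc, sub_eq_add_neg] using hdesc

lemma cover.isFiberAdditive [EssentiallySmall.{w} 𝒜] (X : 𝒜 ⥤ Type w) :
    IsFiberAdditive (cover X) where
  exists_lift {a c} t t' h := by
    obtain ⟨s, v, g, g', rfl, rfl⟩ := exists_eq_mk_of_map_eq (h a)
    exact ⟨mk v (biprod.lift g g'), by rw [map_mk, biprod.lift_fst],
      by rw [map_mk, biprod.lift_snd]⟩
  ext {a c} t t' h₁ h₂ := by
    obtain ⟨s, v, g, g', rfl, rfl⟩ := exists_eq_mk_of_map_eq h₁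
    rw [map_mk, map_mk] at h₁ h₂
    exact congrArg (mk v) (biprod.hom_ext _ _ (mk_injective v h₁) (mk_injective v h₂))

end Linearization

/-! ### The Čech nerve of a morphism of functors to sets -/

section Cech

variable {𝒜 : Type u} [Category.{v} 𝒜] {k : Type w} [Field k] {P X : 𝒜 ⥤ Type w} (π : P ⟶ X)

/-- An element at `a` of the `p`-th fibre power of `P` over `X`. The element of `X` is recorded so
that the power of exponent zero is `X`. -/
@[ext]
structure FiberPower (p : ℕ) (a : 𝒜) where
  base : X.obj a
  comp (i : Fin p) : P.obj a
  π_comp (i : Fin p) : π.app a (comp i) = base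

/-- The `p`-th fibre power of `P` over `X`, the term of degree `p - 1` of the augmented Čech
nerve. -/
abbrev cech (p : ℕ) : 𝒜 ⥤ Type w where
  obj a := FiberPower π p a
  map f := ↾fun y => ⟨X.map f y.base, fun i => P.map f (y.comp i), fun i => by
    rw [NatTrans.naturality_apply, y.π_comp]⟩
  map_id _ := by
    ext y
    · exact X.map_id_apply _ _
    · exact P.map_id_apply _ _
  map_comp f g := by
    ext y
    · exact X.map_comp_apply f g _
    · exact P.map_comp_apply f g _

variable {π} {p : ℕ} {a b : 𝒜}

namespace FiberPower

/-- Adding a component in front. -/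
def cons (t : P.obj a) (y : FiberPower π p a) (h : π.app a t = y.base) :
    FiberPower π (p + 1) a where
  base := y.base
  comp := Fin.cons t y.comp
  π_comp := Fin.cases h y.π_comp

/-- Omitting a component. -/
def face (i : Fin (p + 1)) (y : FiberPower π (p + 1) a) : FiberPower π p a where
  base := y.base
  comp j := y.comp (i.succAbove j)
  π_comp _ := y.π_comp _

lemma face_zero_cons (t : P.obj a) (y : FiberPower π p a) (h : π.app a t = y.base) :
    face 0 (cons t y h) = y := rfl

lemma face_succ_cons (t : P.obj a) (y : FiberPower π (p + 1) a) (h : π.app a t = y.base)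
    (i : Fin (p + 1)) : face i.succ (cons t y h) = cons t (face i y) h :=
  FiberPower.ext rfl (funext <| Fin.cases rfl fun j =>
    congrArg (cons t y h).comp (Fin.succ_succAbove_succ i j))

lemma cons_comp_zero (y : FiberPower π (p + 1) a) :
    cons (y.comp 0) (face 0 y) (y.π_comp 0) = y :=
  FiberPower.ext rfl (funext <| Fin.cases rfl fun _ => rfl)

end FiberPower

open FiberPower

namespace cech

lemma map_cons (f : a ⟶ b) (t : P.obj a) (y : (cech π p).obj a) (h : π.app a t = y.base) :
    (cech π (p + 1)).map f (cons t y h) = cons (P.map f t) ((cech π p).map f y)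
      ((NatTrans.naturality_apply π f t).trans (congrArg _ h)) :=
  FiberPower.ext rfl (funext <| Fin.cases rfl fun _ => rfl)

lemma map_face (f : a ⟶ b) (i : Fin (p + 1)) (y : (cech π (p + 1)).obj a) :
    (cech π p).map f (face i y) = face i ((cech π (p + 1)).map f y) := rfl

/-- The fibre power of exponent zero is the base. -/
def zeroIso (π : P ⟶ X) : cech π 0 ≅ X :=
  NatIso.ofComponents (fun _ => Equiv.toIso
    { toFun y := y.base
      invFun v := ⟨v, Fin.elim0, fun i => i.elim0⟩
      left_inv _ := FiberPower.ext rfl (funext fun i => i.elim0)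
      right_inv _ := rfl }) fun _ => rfl

/-- The fibre power of exponent one is the covering functor. -/
def oneIso (π : P ⟶ X) : cech π 1 ≅ P :=
  NatIso.ofComponents (fun a => Equiv.toIso
    { toFun y := y.comp 0
      invFun t := ⟨π.app a t, fun _ => t, fun _ => rfl⟩
      left_inv y := FiberPower.ext (y.π_comp 0)
        (funext fun _ => congrArg y.comp (Subsingleton.elim _ _))
      right_inv _ := rfl }) fun _ => rfl

variable (k π) in
/-- The differential of the Čech complex. -/
def d (p : ℕ) : lin k (cech π (p + 1)) ⟶ lin k (cech π p) :=
  linDesc (fun _ y => ∑ i : Fin (p + 1), ((-1 : k) ^ (i : ℕ)) • pt k (face i y))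
    fun f y => by
      rw [map_sum]
      refine Finset.sum_congr rfl fun i _ => ?_
      rw [map_smul, lin_map_pt, map_face]

lemma d_pt (y : (cech π (p + 1)).obj a) : (d k π p).app a (pt k y) =
    ∑ i : Fin (p + 1), ((-1 : k) ^ (i : ℕ)) • pt k (X := cech π p) (face i y) :=
  ModuleCat.freeDesc_apply _ _

lemma d_pt_cons_zero (t : P.obj a) (y : (cech π 0).obj a) (h : π.app a t = y.base) :
    (d k π 0).app a (pt k (X := cech π 1) (cons t y h)) = pt k y := by
  rw [d_pt, Fin.sum_univ_one, face_zero_cons, Fin.val_zero, pow_zero, one_smul]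

lemma d_pt_cons_succ (t : P.obj a) (y : (cech π (p + 1)).obj a) (h : π.app a t = y.base) :
    (d k π (p + 1)).app a (pt k (X := cech π (p + 2)) (cons t y h)) =
      pt k y - ∑ i : Fin (p + 1), ((-1 : k) ^ (i : ℕ)) •
        pt k (X := cech π (p + 1)) (cons t (face i y) h) := by
  rw [d_pt, Fin.sum_univ_succ, face_zero_cons, Fin.val_zero, pow_zero, one_smul, sub_eq_add_neg,
    ← Finset.sum_neg_distrib]
  refine congrArg (_ + ·) (Finset.sum_congr rfl fun i _ => ?_)
  rw [face_succ_cons, Fin.val_succ, pow_succ, mul_neg_one, neg_smul]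

section Homotopy

variable (k) (σ : X.obj a → P.obj a) (hσ : ∀ v, π.app a (σ v) = v)

/-- The contracting homotopy of the Čech complex at `a` given by a section of `π` at `a`. -/
def homotopy (p : ℕ) : (lin k (cech π p)).obj a ⟶ (lin k (cech π (p + 1))).obj a :=
  ModuleCat.freeDesc (↾fun y : (cech π p).obj a =>
    pt k (X := cech π (p + 1)) (cons (σ y.base) y (hσ _)))

variable {k}

lemma homotopy_pt (y : (cech π p).obj a) :
    homotopy k σ hσ p (pt k y) = pt k (X := cech π (p + 1)) (cons (σ y.base) y (hσ _)) :=
  ModuleCat.freeDesc_apply _ _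

lemma homotopy_comp_d_zero : homotopy k σ hσ 0 ≫ (d k π 0).app a = 𝟙 _ :=
  ModuleCat.free_hom_ext fun y =>
    (congrArg _ (homotopy_pt σ hσ y)).trans (d_pt_cons_zero _ _ _)

lemma homotopy_comp_d_succ : homotopy k σ hσ (p + 1) ≫ (d k π (p + 1)).app a =
    𝟙 _ - (d k π p).app a ≫ homotopy k σ hσ p :=
  ModuleCat.free_hom_ext fun (y : (cech π (p + 1)).obj a) => by
    change (d k π (p + 1)).app a (homotopy k σ hσ (p + 1) (pt k y)) =
      pt k y - homotopy k σ hσ p ((d k π p).app a (pt k y))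
    rw [homotopy_pt, d_pt_cons_succ, d_pt, map_sum]
    refine congrArg (_ - ·) (Finset.sum_congr rfl fun i _ => ?_)
    rw [map_smul, homotopy_pt]
    rfl

end Homotopy

lemma exists_homotopy_pt_eq (hπ : Function.Surjective (π.app a)) (y : (cech π (p + 1)).obj a) :
    ∃ (σ : X.obj a → P.obj a) (hσ : ∀ v, π.app a (σ v) = v),
      homotopy k σ hσ p (pt k (X := cech π p) (face 0 y)) = pt k y := by
  classical
  let σ := Function.update (Function.surjInv hπ) y.base (y.comp 0)
  have hσ (v : X.obj a) : π.app a (σ v) = v := by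
    by_cases h : v = y.base
    · subst h
      exact (congrArg _ (Function.update_self _ _ _)).trans (y.π_comp 0)
    · exact (congrArg _ (Function.update_of_ne h _ _)).trans (Function.surjInv_eq hπ v)
  refine ⟨σ, hσ, (homotopy_pt σ hσ _).trans (congrArg (pt k) ?_)⟩
  refine Eq.trans ?_ (cons_comp_zero y)
  congr 1
  exact Function.update_self _ _ _

section Exact

variable (hπ : ∀ a, Function.Surjective (π.app a))

include hπ

/-- A basis element is in the image of a contracting homotopy `h`, and `d h = 1 - h d` gives
`d² h = d - d h d = h d²`. -/
lemma d_comp_d (p : ℕ) : d k π (p + 1) ≫ d k π p = 0 := by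
  refine lin_hom_ext fun a y => ?_
  obtain ⟨σ, hσ, h⟩ := exists_homotopy_pt_eq (k := k) (hπ a) y
  have hd : homotopy k σ hσ (p + 1) ≫ (d k π (p + 1)).app a ≫ (d k π p).app a = 0 := by
    rw [← Category.assoc, homotopy_comp_d_succ, Preadditive.sub_comp, Category.id_comp,
      Category.assoc, sub_eq_zero]
    cases p with
    | zero => rw [homotopy_comp_d_zero, Category.comp_id]
    | succ p =>
      rw [homotopy_comp_d_succ, Preadditive.comp_sub, Category.comp_id, ← Category.assoc,
        ← NatTrans.comp_app, d_comp_d p, NatTrans.app_zero, zero_comp, sub_zero]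
  exact h ▸ congr($hd (pt k (X := cech π (p + 1)) (face 0 y)))

lemma exists_section (a : 𝒜) : ∃ σ : X.obj a → P.obj a, ∀ v, π.app a (σ v) = v :=
  ⟨_, Function.surjInv_eq (hπ a)⟩

lemma epi_d_zero : Epi (d k π 0) := (FunRep.epi_iff _).2 fun a z => by
  obtain ⟨σ, hσ⟩ := exists_section hπ a
  exact ⟨_, congr($(homotopy_comp_d_zero σ hσ) z)⟩

lemma exact_d (p : ℕ) : (ShortComplex.mk _ _ (d_comp_d (k := k) hπ p)).Exact :=
  (FunRep.exact_iff _).2 fun a (z : (lin k (cech π (p + 1))).obj a) hz => by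
    obtain ⟨σ, hσ⟩ := exists_section hπ a
    refine ⟨homotopy k σ hσ (p + 1) z, congr($(homotopy_comp_d_succ σ hσ) z).trans ?_⟩
    change z - homotopy k σ hσ p ((d k π p).app a z) = z
    rw [show (d k π p).app a z = 0 from hz, map_zero, sub_zero]

end Exact

end cech

/-! ### Means -/

variable (π)

/-- A morphism `f` out of `a` together with a lift to `P` of the image by `f` of `v`. -/
structure LiftIdx (v : X.obj a) where
  target : 𝒜
  hom : a ⟶ target
  lift : P.obj target
  π_lift : π.app target lift = X.map hom v

variable {π}

namespace LiftIdx

/-- Postcomposition with a morphism. -/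
def push {v : X.obj a} (i : LiftIdx π v) {c : 𝒜} (g : i.target ⟶ c) : LiftIdx π v where
  target := c
  hom := i.hom ≫ g
  lift := P.map g i.lift
  π_lift := by rw [NatTrans.naturality_apply, i.π_lift, Functor.map_comp_apply]

/-- Precomposition with a morphism. -/
def pull (f : a ⟶ b) {v : X.obj a} (i : LiftIdx π (X.map f v)) : LiftIdx π v where
  target := i.target
  hom := f ≫ i.hom
  lift := i.lift
  π_lift := by rw [i.π_lift, Functor.map_comp_apply]

end LiftIdx

variable (π) (F : FunRep k 𝒜)

/-- The natural families of elements of `F` indexed by the lifts to `P` of the images of `v`. -/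
def Family (v : X.obj a) : Submodule k (∀ i : LiftIdx π v, F.obj i.target) where
  carrier := {θ | ∀ (i : LiftIdx π v) (c : 𝒜) (g : i.target ⟶ c), θ (i.push g) = F.map g (θ i)}
  zero_mem' _ _ _ := (map_zero _).symm
  add_mem' h h' i c g := (congrArg₂ (· + ·) (h i c g) (h' i c g)).trans (map_add _ _ _).symm
  smul_mem' r _ h i c g := (congrArg (r • ·) (h i c g)).trans (map_smul _ _ _).symm

variable {π F}

namespace Family

/-- The family induced by an element of `F`. -/
def const (v : X.obj a) (z : F.obj a) : Family π F v :=
  ⟨fun i => F.map i.hom z, fun i _ g => F.map_comp_apply i.hom g z⟩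

lemma congr {v : X.obj a} (θ : Family π F v) (c : 𝒜) {f f' : a ⟶ c} (hf : f = f')
    {t t' : P.obj c} (ht : t = t') (h : π.app c t = X.map f v) (h' : π.app c t' = X.map f' v) :
    θ.1 ⟨c, f, t, h⟩ = θ.1 ⟨c, f', t', h'⟩ := by
  subst hf ht
  rfl

/-- The restriction of a family along a morphism. -/
def restrict (f : a ⟶ b) {v : X.obj a} (θ : Family π F v) : Family π F (X.map f v) :=
  ⟨fun i => θ.1 i.pull, fun i c g =>
    (congr θ c (Category.assoc _ _ _).symm rfl _ _).trans (θ.2 i.pull c g)⟩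

/-- The values of a morphism out of the Čech nerve on the elements obtained by adding a component
to the images of `y`. -/
def cons (φ : lin k (cech π (p + 1)) ⟶ F) (y : (cech π p).obj a) : Family π F y.base :=
  ⟨fun i => φ.app i.target (pt k (X := cech π (p + 1))
      (FiberPower.cons i.lift ((cech π p).map i.hom y) i.π_lift)), fun i c g => by
    refine Eq.trans ?_ (app_pt_naturality φ g _)
    refine congrArg (fun z => φ.app c (pt k z)) (Eq.trans ?_ (cech.map_cons _ _ _ _).symm)
    congr 1
    exact Functor.map_comp_apply (cech π p) _ _ _⟩

lemma restrict_cons (φ : lin k (cech π (p + 1)) ⟶ F) (f : a ⟶ b) (y : (cech π p).obj a) :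
    restrict f (cons φ y) = cons φ ((cech π p).map f y) := by
  refine Subtype.ext (funext fun i => ?_)
  refine congrArg (fun z => φ.app i.target (pt k z)) ?_
  congr 1
  exact Functor.map_comp_apply (cech π p) _ _ _

end Family

variable (π F)

/-- A natural way to average the natural families of elements of `F`. -/
structure Mean where
  val {a : 𝒜} (v : X.obj a) : Family π F v →ₗ[k] F.obj a
  map_val {a b : 𝒜} (f : a ⟶ b) (v : X.obj a) (θ : Family π F v) :
    F.map f (val v θ) = val (X.map f v) (Family.restrict f θ)
  val_const {a : 𝒜} (v : X.obj a) (z : F.obj a) : val v (Family.const v z) = z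

variable {π F}

lemma cech.hom_pt_eq_sum (φ : lin k (cech π (p + 1)) ⟶ F) (hφ : d k π (p + 1) ≫ φ = 0)
    (t : P.obj a) (y : (cech π (p + 1)).obj a) (h : π.app a t = y.base) :
    φ.app a (pt k y) = ∑ i : Fin (p + 1), (-1 : k) ^ (i : ℕ) •
      φ.app a (pt k (X := cech π (p + 1)) (cons t (face i y) h)) := by
  have hcons : φ.app a ((d k π (p + 1)).app a (pt k (X := cech π (p + 2)) (cons t y h))) = 0 :=
    congr($(hφ).app a (pt k (X := cech π (p + 2)) (cons t y h)))
  rw [d_pt_cons_succ, map_sub, sub_eq_zero, map_sum] at hcons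
  simpa only [map_smul] using hcons

/-- The mean over `t` of the homotopies that add the component `t` makes the complex of morphisms
from the Čech complex to `F` exact, even when `π` has no natural section. -/
lemma Mean.exists_comp_eq (m : Mean π F) (φ : lin k (cech π (p + 1)) ⟶ F)
    (hφ : cech.d k π (p + 1) ≫ φ = 0) : ∃ χ : lin k (cech π p) ⟶ F, cech.d k π p ≫ χ = φ := by
  refine ⟨linDesc (fun _ y => m.val _ (Family.cons φ y)) fun {a b} f y => ?_,
    lin_hom_ext fun a (y : (cech π (p + 1)).obj a) => ?_⟩
  · rw [m.map_val, Family.restrict_cons]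
    rfl
  · let θ (i : Fin (p + 1)) : Family π F y.base := Family.cons φ (face i y)
    have hθ : ∑ i : Fin (p + 1), (-1 : k) ^ (i : ℕ) • θ i =
        Family.const y.base (φ.app a (pt k y)) := by
      refine Subtype.ext (funext fun i => ?_)
      rw [Submodule.coe_sum, Finset.sum_apply]
      exact (cech.hom_pt_eq_sum φ hφ i.lift ((cech π (p + 1)).map i.hom y) i.π_lift).symm.trans
        (app_pt_naturality φ i.hom y)
    rw [NatTrans.comp_app_apply, cech.d_pt, map_sum, ← m.val_const y.base (φ.app a (pt k y)),
      ← hθ, map_sum]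
    refine Finset.sum_congr rfl fun i _ => ?_
    rw [map_smul, linDesc_pt]
    exact (map_smul (m.val y.base) _ _).symm

end Cech

section Vanishing

universe t

variable {𝒜 : Type u} [Category.{v} 𝒜] {k : Type w} [Field k] [HasExt.{t} (FunRep k 𝒜)]
  {F : FunRep k 𝒜}

open Abelian

lemma subsingleton_ext_lin_of_cech {P X : 𝒜 ⥤ Type w} {π : P ⟶ X}
    (hπ : ∀ a, Function.Surjective (π.app a)) (n : ℕ)
    (exact_hom : ∀ p (φ : lin k (cech π (p + 2)) ⟶ F), cech.d k π (p + 2) ≫ φ = 0 →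
      ∃ χ : lin k (cech π (p + 1)) ⟶ F, cech.d k π (p + 1) ≫ χ = φ)
    (acyclic : ∀ p i, p + i ≤ n → Subsingleton (Ext (lin k (cech π (p + 1))) F (i + 1))) :
    Subsingleton (Ext (lin k X) F (n + 1)) :=
  have := cech.epi_d_zero (k := k) hπ
  subsingleton_ext_of_iso (Functor.isoWhiskerRight (cech.zeroIso π) (ModuleCat.free k))
    (subsingleton_ext_of_resolution n (K := fun p => lin k (cech π (p + 1)))
      (cech.d k π 0) (fun p => cech.d k π (p + 1)) (cech.d_comp_d hπ 0)
      (fun p => cech.d_comp_d hπ (p + 1)) (cech.exact_d hπ 0) (fun p => cech.exact_d hπ (p + 1))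
      exact_hom acyclic)

variable [Preadditive 𝒜] [HasFiniteBiproducts 𝒜]

attribute [local instance] hasBinaryBiproducts_of_finite_biproducts

lemma IsFiberAdditive.cech_succ {P X : 𝒜 ⥤ Type w} (hP : IsFiberAdditive P)
    (hX : ∀ {a c : 𝒜} {v v' : X.obj (a ⊞ c)}, X.map biprod.fst v = X.map biprod.fst v' →
      X.map biprod.snd v = X.map biprod.snd v' → v = v') (π : P ⟶ X) (p : ℕ) :
    IsFiberAdditive (cech π (p + 1)) where
  exists_lift {a c} y y' h := by
    choose t ht ht' using fun i => hP.exists_lift (y.comp i) (y'.comp i)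
      fun e => congrArg (fun y => FiberPower.comp y i) (h e)
    refine ⟨⟨π.app _ (t 0), t, fun i => hX ?_ ?_⟩, FiberPower.ext ?_ (funext ht),
      FiberPower.ext ?_ (funext ht')⟩
    · rw [← NatTrans.naturality_apply, ← NatTrans.naturality_apply, ht, ht, y.π_comp, y.π_comp]
    · rw [← NatTrans.naturality_apply, ← NatTrans.naturality_apply, ht', ht', y'.π_comp, y'.π_comp]
    · exact (NatTrans.naturality_apply π _ _).symm.trans ((congrArg _ (ht 0)).trans (y.π_comp 0))
    · exact (NatTrans.naturality_apply π _ _).symm.trans ((congrArg _ (ht' 0)).trans (y'.π_comp 0))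
  ext {a c} y y' h h' := FiberPower.ext
    (hX (congrArg FiberPower.base h) (congrArg FiberPower.base h'))
    (funext fun i => hP.ext (congrArg (fun y => FiberPower.comp y i) h)
      (congrArg (fun y => FiberPower.comp y i) h'))

theorem subsingleton_ext_lin_of_mean [EssentiallySmall.{w} 𝒜]
    (hF : ∀ X : 𝒜 ⥤ Type w, IsFiberAdditive X → Nonempty (Mean (cover.π X) F)) {X : 𝒜 ⥤ Type w}
    (hX : IsFiberAdditive X) (n : ℕ) : Subsingleton (Ext (lin k X) F (n + 1)) := by
  induction n using Nat.strong_induction_on generalizing X with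
  | h n ih =>
  obtain ⟨m⟩ := hF X hX
  refine subsingleton_ext_lin_of_cech cover.π_surjective n (fun p φ hφ => m.exists_comp_eq φ hφ)
    fun p i hpi => ?_
  cases p with
  | zero =>
    have : Projective (lin k (cech (cover.π X) 1)) := Projective.of_iso
      (Functor.isoWhiskerRight (cech.oneIso (cover.π X)) (ModuleCat.free k)).symm inferInstance
    exact Ext.subsingleton_of_projective _ _ _
  | succ p => exact ih i (by lia) ((cover.isFiberAdditive X).cech_succ hX.ext _ _)

end Vanishing

/-! ### Generalised limits with values in an injective module -/

section GenLim

open scoped MonoidAlgebra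

/-- An equivariant linear functional on the families of elements of `V` indexed by `D`, extending
the limit of families that are eventually constant along `l`. -/
structure GenLim {k : Type*} [Field k] {G : Type*} [Group G] (V : Rep.{w} k G) {D : Type*}
    (l : Filter D) where
  lim : (D → V) →ₗ[k] V
  lim_ρ (g : G) (h : D → V) : lim (fun d => V.ρ g (h d)) = V.ρ g (lim h)
  lim_const (j : V) : lim (fun _ => j) = j
  lim_congr {h h' : D → V} (e : h =ᶠ[l] h') : lim h = lim h'

lemma exists_linearMap_germ_extension {R : Type*} [Ring R] [Small.{w} R] (J : Type w)
    [AddCommGroup J] [Module R J] [Module.Injective R J] {D : Type*} (l : Filter D) [l.NeBot] :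
    ∃ L : (D → J) →ₗ[R] J, (∀ j, L (fun _ => j) = j) ∧ ∀ h h', h =ᶠ[l] h' → L h = L h' := by
  let const : J →ₗ[R] l.Germ J :=
    { toFun j := (j : l.Germ J)
      map_add' _ _ := rfl
      map_smul' _ _ := rfl }
  let germ : (D → J) →ₗ[R] l.Germ J :=
    { toFun h := (h : l.Germ J)
      map_add' _ _ := rfl
      map_smul' _ _ := rfl }
  obtain ⟨r, hr⟩ := Module.Injective.extension_property R J J (l.Germ J) const
    (fun _ _ h => Filter.Germ.const_inj.1 h) LinearMap.id
  exact ⟨r ∘ₗ germ, fun j => congr($hr j), fun _ _ e => congrArg r (Filter.Germ.coe_eq.2 e)⟩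

lemma nonempty_genLim {k : Type*} [Field k] {G : Type*} [Group G] [Small.{w} k[G]]
    (J : ModuleCat.{w} k[G]) [Injective J] {D : Type*} (l : Filter D) [l.NeBot] :
    Nonempty (GenLim (Rep.ofModuleMonoidAlgebra.obj J) l) := by
  have : Module.Injective k[G] J := Module.injective_module_of_injective_object _ _
  obtain ⟨L, hconst, hcongr⟩ := exists_linearMap_germ_extension (R := k[G]) J l
  exact ⟨{
    lim :=
      { toFun := L
        map_add' := L.map_add
        map_smul' r := L.map_smul (algebraMap k k[G] r) }
    lim_ρ g := L.map_smul (MonoidAlgebra.single g 1)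
    lim_const := hconst
    lim_congr := hcongr _ _ }⟩

end GenLim

/-! ### Means on the functors `Q_{B, V}` -/

section QRepMean

variable {𝒜 : Type u} [Category.{v} 𝒜] [Preadditive 𝒜] [HasFiniteBiproducts 𝒜]

attribute [local instance] hasBinaryBiproducts_of_finite_biproducts

section Shear

variable {a b c s : 𝒜}

/-- The morphism `(x, y) ↦ (f x + q y, y)`. -/
def shear (f : a ⟶ b) (q : c ⟶ b) : a ⊞ c ⟶ b ⊞ c :=
  biprod.lift (biprod.desc f q) biprod.snd

lemma inl_shear (f : a ⟶ b) (q : c ⟶ b) : biprod.inl ≫ shear f q = f ≫ biprod.inl := by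
  apply biprod.hom_ext <;> simp [shear]

lemma lift_shear (g : s ⟶ a) (r : s ⟶ c) (f : a ⟶ b) (q : c ⟶ b) :
    biprod.lift g r ≫ shear f q = biprod.lift (g ≫ f + r ≫ q) r := by
  apply biprod.hom_ext <;> simp [shear, biprod.lift_desc]

variable {B : AddRep.{w} 𝒜}

lemma AddRep.map_fst_map_inl (y : B.obj.obj a) :
    B.obj.map (biprod.fst : a ⊞ c ⟶ a) (B.obj.map biprod.inl y) = y := by
  rw [← Functor.map_comp_apply, biprod.inl_fst, Functor.map_id_apply]

lemma IsGenerating.map_inl {β : B.obj.obj a} (hβ : IsGenerating β) :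
    IsGenerating (B.obj.map (biprod.inl : a ⟶ a ⊞ c) β) :=
  .of_map biprod.fst (by rwa [AddRep.map_fst_map_inl])

lemma AddRep.map_shear_eq_map_inl_iff (f : a ⟶ b) (q : c ⟶ b) (y : B.obj.obj (a ⊞ c))
    (β : B.obj.obj b) : B.obj.map (shear f q) y = B.obj.map biprod.inl β ↔
      ∃ α, B.obj.map biprod.inl α = y ∧ B.obj.map f α = β := by
  constructor
  · intro h
    have hsnd : B.obj.map biprod.snd y = 0 := by
      have hsnd := congrArg (B.obj.map biprod.snd) h
      rwa [← Functor.map_comp_apply, ← Functor.map_comp_apply, shear, biprod.lift_snd,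
        biprod.inl_snd, AddRep.map_zero_apply] at hsnd
    have hinl : B.obj.map biprod.inl (B.obj.map biprod.fst y) = y := by
      conv_rhs => rw [← B.obj.map_id_apply _ y, ← biprod.total, AddRep.map_add_apply,
        Functor.map_comp_apply, Functor.map_comp_apply, hsnd, map_zero, add_zero]
    refine ⟨_, hinl, ?_⟩
    rw [← hinl, ← Functor.map_comp_apply, inl_shear, Functor.map_comp_apply] at h
    rw [← AddRep.map_fst_map_inl (B.obj.map f _), h, AddRep.map_fst_map_inl]
  · rintro ⟨α, rfl, rfl⟩
    rw [← Functor.map_comp_apply, inl_shear, Functor.map_comp_apply]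

variable {k : Type w} [Field k] {V : Rep.{w} k (Aut B)} [∀ a, Finite (B.obj.obj a)]

open scoped Classical in
lemma QRep.coeff_inl_map_shear [Fintype (B.obj.obj a)] (f : a ⟶ b) (q : c ⟶ b) {β : B.obj.obj b}
    (hβ : IsGenerating β) (z : (QRep V).obj (a ⊞ c)) :
    coeff V (B.obj.map biprod.inl β) ((QRep V).map (shear f q) z) =
      ∑ α with B.obj.map f α = β, coeff V (B.obj.map biprod.inl α) z := by
  have := Fintype.ofFinite (B.obj.obj (a ⊞ c))
  have hinj : Function.Injective (B.obj.map (biprod.inl : a ⟶ a ⊞ c)) :=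
    Function.LeftInverse.injective AddRep.map_fst_map_inl
  rw [coeff_map _ hβ.map_inl, ← Finset.sum_image (f := fun y => coeff V y z) hinj.injOn]
  refine Finset.sum_congr (Finset.ext fun y => ?_) fun _ _ => rfl
  simp only [Finset.mem_filter_univ, AddRep.map_shear_eq_map_inl_iff, Finset.mem_image, and_comm]

lemma QRep.coeff_inl_map_inl {β : B.obj.obj a} (hβ : IsGenerating β) (z : (QRep V).obj a) :
    coeff V (B.obj.map biprod.inl β) ((QRep V).map (biprod.inl : a ⟶ a ⊞ c) z) = coeff V β z := by
  classical
  have := Fintype.ofFinite (B.obj.obj a)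
  have hinj : Function.Injective (B.obj.map (biprod.inl : a ⟶ a ⊞ c)) :=
    Function.LeftInverse.injective AddRep.map_fst_map_inl
  rw [coeff_map _ hβ.map_inl]
  simp only [hinj.eq_iff, Finset.sum_filter, Finset.sum_ite_eq', Finset.mem_univ, if_true]

end Shear

variable [EssentiallySmall.{w} 𝒜]

/-- An element of `X` together with a morphism which acts on it as the zero morphism. -/
structure LimIdx (X : 𝒜 ⥤ Type w) where
  source : SmallModel.{w} 𝒜
  elt : X.obj (ofModel source)
  target : 𝒜
  hom : ofModel source ⟶ target
  map_hom : X.map hom elt = X.map 0 elt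

variable {X : 𝒜 ⥤ Type w} (hX : IsFiberAdditive X) {a b : 𝒜}

/-- The filter of the sets containing all indices whose element is general enough in the component
of `v` and, depending on this element, whose morphism is universal enough. -/
def limFilter (v : X.obj a) : Filter (LimIdx X) where
  sets := {S | ∃ (x₀ : 𝒜) (v₀ : X.obj x₀), SameComponent X v v₀ ∧
    ∀ (s : SmallModel.{w} 𝒜) (v₁ : X.obj (ofModel s)) (g : ofModel s ⟶ x₀), X.map g v₁ = v₀ →
      ∃ (c₀ : 𝒜) (r₀ : ofModel s ⟶ c₀), X.map r₀ v₁ = X.map 0 v₁ ∧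
        ∀ (c : 𝒜) (r : ofModel s ⟶ c) (hr : X.map r v₁ = X.map 0 v₁), (∃ h, r ≫ h = r₀) →
          ⟨s, v₁, c, r, hr⟩ ∈ S}
  univ_sets := ⟨a, v, fun _ => rfl, fun s v₁ g _ =>
    ⟨ofModel s, 0, rfl, fun _ _ _ _ => trivial⟩⟩
  sets_of_superset := by
    rintro S T ⟨x₀, v₀, h₀, h⟩ hST
    refine ⟨x₀, v₀, h₀, fun s v₁ g hg => ?_⟩
    obtain ⟨c₀, r₀, hr₀, h⟩ := h s v₁ g hg
    exact ⟨c₀, r₀, hr₀, fun c r hr hh => hST (h c r hr hh)⟩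
  inter_sets := by
    rintro S T ⟨x₀, v₀, h₀, h⟩ ⟨x₀', v₀', h₀', h'⟩
    obtain ⟨t, ht, ht'⟩ := hX.exists_lift v₀ v₀' (h₀.symm.trans h₀')
    refine ⟨x₀ ⊞ x₀', t, h₀.trans (ht ▸ (SameComponent.map t _).symm), fun s v₁ g hg => ?_⟩
    obtain ⟨c₀, r₀, hr₀, h⟩ := h s v₁ (g ≫ biprod.fst) (by rw [Functor.map_comp_apply, hg, ht])
    obtain ⟨c₀', r₀', hr₀', h'⟩ :=
      h' s v₁ (g ≫ biprod.snd) (by rw [Functor.map_comp_apply, hg, ht'])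
    refine ⟨c₀ ⊞ c₀', biprod.lift r₀ r₀', hX.ext ?_ ?_, ?_⟩
    · simp only [← Functor.map_comp_apply, biprod.lift_fst, hr₀, zero_comp]
    · simp only [← Functor.map_comp_apply, biprod.lift_snd, hr₀', zero_comp]
    · rintro c r hr ⟨q, hq⟩
      exact ⟨h c r hr ⟨q ≫ biprod.fst, by rw [← Category.assoc, hq, biprod.lift_fst]⟩,
        h' c r hr ⟨q ≫ biprod.snd, by rw [← Category.assoc, hq, biprod.lift_snd]⟩⟩

instance (v : X.obj a) : (limFilter hX v).NeBot := by
  refine Filter.neBot_iff.2 fun hbot => ?_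
  obtain ⟨x₀, v₀, -, h⟩ := Filter.empty_mem_iff_bot.2 hbot
  obtain ⟨s, ⟨e⟩⟩ := exists_ofModel_iso.{w} x₀
  obtain ⟨c₀, r₀, hr₀, h⟩ := h s (X.map e.inv v₀) e.hom
    (by rw [← Functor.map_comp_apply, e.inv_hom_id, Functor.map_id_apply])
  exact h c₀ r₀ hr₀ ⟨𝟙 _, Category.comp_id _⟩

lemma limFilter_map (f : a ⟶ b) (v : X.obj a) :
    limFilter hX (X.map f v) = limFilter hX v := by
  refine Filter.ext fun S => exists_congr fun x₀ => exists_congr fun v₀ => and_congr_left' ?_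
  exact ⟨(SameComponent.map v f).trans, (SameComponent.map v f).symm.trans⟩

variable {k : Type w} [Field k]

namespace LimIdx

include hX in
lemma π_mk_lift (d : LimIdx X) (g : ofModel d.source ⟶ a) :
    (cover.π X).app _ (cover.mk d.elt (biprod.lift g d.hom)) =
      X.map (biprod.inl : a ⟶ a ⊞ d.target) (X.map g d.elt) := by
  rw [cover.π_mk]
  apply hX.ext
  · simp only [← Functor.map_comp_apply, biprod.lift_fst, biprod.inl_fst, Category.comp_id,
      Category.assoc]
  · simp only [← Functor.map_comp_apply, biprod.lift_snd, biprod.inl_snd, comp_zero,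
      Category.assoc, d.map_hom]

/-- The lift to the cover of the image of `v` in `X(a ⊞ d.target)`, for an index `d` whose element
is sent to `v` by `g`. -/
abbrev liftIdx (d : LimIdx X) {v : X.obj a} (g : ofModel d.source ⟶ a) (hg : X.map g d.elt = v) :
    LiftIdx (cover.π X) v where
  target := a ⊞ d.target
  hom := biprod.inl
  lift := cover.mk d.elt (biprod.lift g d.hom)
  π_lift := (d.π_mk_lift hX g).trans (congrArg _ hg)

lemma restrict_liftIdx {F : FunRep k 𝒜} {v : X.obj a} (θ : Family (cover.π X) F v) (d : LimIdx X)
    {g : ofModel d.source ⟶ a} (hg : X.map g d.elt = v) (f : a ⟶ b) {g' : ofModel d.source ⟶ b}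
    (hg' : X.map g' d.elt = X.map f v) {q : d.target ⟶ b} (hq : g ≫ f + d.hom ≫ q = g') :
    (Family.restrict f θ).1 (d.liftIdx hX g' hg') =
      F.map (shear f q) (θ.1 (d.liftIdx hX g hg)) :=
  (Family.congr θ _ (inl_shear f q).symm
    ((congrArg (cover.mk d.elt) (by rw [lift_shear, hq])).trans (cover.map_mk ..).symm)
    (d.liftIdx hX g' hg').pull.π_lift
    ((d.liftIdx hX g hg).push (shear f q)).π_lift).trans (θ.2 (d.liftIdx hX g hg) _ (shear f q))

end LimIdx

variable {B : AddRep.{w} 𝒜} {V : Rep.{w} k (Aut B)}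

open scoped Classical in
/-- The families of which the limits are the coefficients at `β` of the mean. -/
def meanTerm (v : X.obj a) (β : B.obj.obj a) :
    Family (cover.π X) (QRep V) v →ₗ[k] LimIdx X → V :=
  LinearMap.pi fun d => if h : ∃ g : ofModel d.source ⟶ a, X.map g d.elt = v then
    QRep.coeff V (B.obj.map biprod.inl β) ∘ₗ
      LinearMap.proj (d.liftIdx hX h.choose h.choose_spec) ∘ₗ Submodule.subtype _
  else 0

lemma meanTerm_apply {v : X.obj a} (θ : Family (cover.π X) (QRep V) v) (β : B.obj.obj a)
    {d : LimIdx X} (h : ∃ g : ofModel d.source ⟶ a, X.map g d.elt = v) : meanTerm hX v β θ d =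
      QRep.coeff V (B.obj.map biprod.inl β) (θ.1 (d.liftIdx hX h.choose h.choose_spec)) := by
  rw [meanTerm, LinearMap.pi_apply, dif_pos h]
  rfl

lemma meanTerm_aut_smul {v : X.obj a} (θ : Family (cover.π X) (QRep V) v) (g : Aut B)
    (β : B.obj.obj a) : meanTerm hX v (g • β) θ = fun d => V.ρ g (meanTerm hX v β θ d) := by
  funext d
  by_cases h : ∃ g : ofModel d.source ⟶ a, X.map g d.elt = v
  · rw [meanTerm_apply hX _ _ h, meanTerm_apply hX _ _ h, map_aut_smul, QRep.coeff_aut_smul]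
  · simp only [meanTerm, LinearMap.pi_apply, dif_neg h, LinearMap.zero_apply, map_zero]

variable [∀ a, Finite (B.obj.obj a)]

lemma meanTerm_const (v : X.obj a) (z : (QRep V).obj a) {β : B.obj.obj a} (hβ : IsGenerating β) :
    meanTerm hX v β (Family.const v z) =ᶠ[limFilter hX v] fun _ => QRep.coeff V β z :=
  ⟨a, v, fun _ => rfl, fun s v₁ g hg => ⟨ofModel s, 0, rfl, fun c r hr _ =>
    (meanTerm_apply hX _ _ (d := ⟨s, v₁, c, r, hr⟩) ⟨g, hg⟩).trans
      (QRep.coeff_inl_map_inl hβ z)⟩⟩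

open scoped Classical in
/-- The two morphisms chosen in the families compared here, to `a` and `b`, are compatible only up
to a morphism acting as zero, which factors through that of a universal enough index. -/
lemma meanTerm_restrict [Fintype (B.obj.obj a)] (f : a ⟶ b) (v : X.obj a)
    (θ : Family (cover.π X) (QRep V) v) {β : B.obj.obj b} (hβ : IsGenerating β) :
    meanTerm hX (X.map f v) β (Family.restrict f θ) =ᶠ[limFilter hX v]
      ∑ α with B.obj.map f α = β, meanTerm hX v α θ := by
  refine ⟨a, v, fun _ => rfl, fun s v₁ g hg => ?_⟩
  have ha : ∃ g : ofModel s ⟶ a, X.map g v₁ = v := ⟨g, hg⟩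
  have hb : ∃ g : ofModel s ⟶ b, X.map g v₁ = X.map f v :=
    ⟨g ≫ f, by rw [Functor.map_comp_apply, hg]⟩
  refine ⟨b, hb.choose - ha.choose ≫ f, hX.map_sub _ _ _ ?_, ?_⟩
  · rw [hb.choose_spec, Functor.map_comp_apply, ha.choose_spec]
  · rintro c r hr ⟨q, hq⟩
    let d : LimIdx X := ⟨s, v₁, c, r, hr⟩
    change meanTerm hX _ β _ d = _
    rw [Finset.sum_apply, meanTerm_apply hX _ _ (d := d) hb,
      d.restrict_liftIdx hX θ ha.choose_spec f hb.choose_spec (q := q)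
        (by rw [hq, add_sub_cancel]), QRep.coeff_inl_map_shear f q hβ]
    exact Finset.sum_congr rfl fun α _ => (meanTerm_apply hX θ α (d := d) ha).symm

include hX in
lemma nonempty_mean (hV : ∀ (l : Filter (LimIdx X)) [l.NeBot], Nonempty (GenLim V l)) :
    Nonempty (Mean (cover.π X) (QRep V)) := by
  classical
  have _ (a : 𝒜) := Fintype.ofFinite (B.obj.obj a)
  let L {a : 𝒜} (v : X.obj a) : GenLim V (limFilter hX v) := (hV (limFilter hX v)).some
  have hL {a b : 𝒜} (f : a ⟶ b) (v : X.obj a) : (L (X.map f v)).lim = (L v).lim := by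
    have lim_some (l l' : Filter (LimIdx X)) [l.NeBot] [l'.NeBot] (h : l = l') :
        (hV l).some.lim = (hV l').some.lim := by
      subst h
      rfl
    exact lim_some _ _ (limFilter_map hX f v)
  choose val hval using fun (a : 𝒜) (v : X.obj a) (θ : Family (cover.π X) (QRep V) v) =>
    QRep.exists_coeff_eq (V := V) (fun β => (L v).lim (meanTerm hX v β θ)) fun g β _ => by
      rw [meanTerm_aut_smul, (L v).lim_ρ]
  refine ⟨⟨fun {a} v =>
    { toFun := val a v
      map_add' θ θ' := QRep.ext_coeff fun β hβ => ?_
      map_smul' r θ := QRep.ext_coeff fun β hβ => ?_ }, fun {a b} f v θ => ?_, fun {a} v z => ?_⟩⟩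
  · simp only [map_add, hval _ _ _ _ hβ]
  · simp only [map_smul, hval _ _ _ _ hβ, RingHom.id_apply]
  · refine QRep.ext_coeff fun β hβ => (QRep.coeff_map (V := V) f hβ (val a v θ)).trans ?_
    refine Eq.trans ?_ (hval _ _ _ _ hβ).symm
    rw [hL, (L v).lim_congr (meanTerm_restrict hX f v θ hβ), map_sum]
    refine Finset.sum_congr rfl fun α hα => hval _ _ _ _ ?_
    rw [Finset.mem_filter_univ] at hα
    exact IsGenerating.of_map f (hα ▸ hβ)
  · refine QRep.ext_coeff fun β hβ => (hval _ _ _ _ hβ).trans ?_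
    rw [(L v).lim_congr (meanTerm_const hX v z hβ), (L v).lim_const]

universe t

include hX in
open scoped MonoidAlgebra in
theorem subsingleton_ext_lin_QFunctor [HasExt.{t} (FunRep k 𝒜)] [Small.{w} k[Aut B]]
    (J : ModuleCat.{w} k[Aut B]) [Injective J] (n : ℕ) :
    Subsingleton (Abelian.Ext (lin k X) ((QFunctor k B).obj J) (n + 1)) :=
  subsingleton_ext_lin_of_mean (F := QRep (Rep.ofModuleMonoidAlgebra.obj J))
    (fun _ hX => nonempty_mean hX fun l _ => nonempty_genLim J l) hX n

end QRepMean

/-! ### Morphisms to the functors `Q_{B, W}` -/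

section QRepHom

variable {𝒜 : Type u} [Category.{v} 𝒜] [Preadditive 𝒜] {A B : AddRep.{w} 𝒜}

lemma SubRep.isIso_of_surjective_of_objLength_le (hB : IsFiniteObject B)
    (h : objLength A ≤ objLength B) (φ : A ⟶ B) (hφ : ∀ a, Function.Surjective (φ.hom.app a)) :
    IsIso φ := by
  have hι : IsIso (⊤ : SubRep A).ι := AddRep.isIso_of_bijective _ fun a =>
    ⟨Subtype.val_injective, fun x => ⟨⟨x, trivial⟩, rfl⟩⟩
  have hcomp : IsIso ((⊤ : SubRep A).ι ≫ φ) :=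
    (eq_top_and_isIso_of_surjective_of_objLength_le hB h ⊤ _ fun a y =>
      (hφ a y).imp' (fun x => ⟨x, trivial⟩) fun _ => id).2
  exact IsIso.of_isIso_comp_left (⊤ : SubRep A).ι φ

lemma IsGenerating.surjective_of_app_eq {a : 𝒜} {y : A.obj.obj a} {β : B.obj.obj a}
    (hβ : IsGenerating β) {φ : A ⟶ B} (hφ : φ.hom.app a y = β) (b : 𝒜) :
    Function.Surjective (φ.hom.app b) := fun z => by
  obtain ⟨f, hf⟩ := hβ z
  exact ⟨A.obj.map f y, by rw [NatTrans.naturality_apply, hφ, hf]⟩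

lemma SubRep.isGenerating_span {a : 𝒜} (y : A.obj.obj a) :
    IsGenerating (A := (span y).toRep) (⟨y, self_mem_span y⟩ : (span y).carrier a) := fun _ z => by
  obtain ⟨f, hf⟩ := (mem_span y z.1).1 z.2
  exact ⟨f, Subtype.ext hf⟩

lemma exists_iso_of_relations (hB : IsFiniteObject B) (hAB : objLength A ≤ objLength B) {a : 𝒜}
    {y : A.obj.obj a} {β : B.obj.obj a} (hβ : IsGenerating β)
    (h : ∀ ⦃c : 𝒜⦄ (r : a ⟶ c), A.obj.map r y = 0 → B.obj.map r β = 0) :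
    ∃ φ : A ≅ B, φ.hom.hom.app a y = β := by
  obtain ⟨φ, hφ⟩ := (SubRep.isGenerating_span y).exists_hom β
    fun c r hr => h r (congrArg Subtype.val hr)
  have htop := (SubRep.eq_top_and_isIso_of_surjective_of_objLength_le hB hAB _ φ
    (hβ.surjective_of_app_eq hφ)).1
  obtain ⟨ψ, hψ⟩ := ((SubRep.span_eq_top_iff y).1 htop).exists_hom β h
  have := SubRep.isIso_of_surjective_of_objLength_le hB hAB ψ (hβ.surjective_of_app_eq hψ)
  exact ⟨asIso ψ, hψ⟩

variable {k : Type w} [Field k]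

lemma QRep.hom_ext {V : Rep.{w} k (Aut A)} {F : FunRep k 𝒜} {τ τ' : QRep V ⟶ F}
    (h : ∀ (a : 𝒜) (v : A.obj.obj a) (m : V), τ.app a (mk V v m) = τ'.app a (mk V v m)) :
    τ = τ' := by
  refine NatTrans.ext (funext fun a => ModuleCat.hom_ext (LinearMap.ext fun z => ?_))
  induction z using QRep.induction with
  | zero => rw [map_zero, map_zero]
  | add x y hx hy => rw [map_add, map_add, hx, hy]
  | mk v m _ => exact h a v m

section Exact

open scoped MonoidAlgebra

lemma QFunctor_map_exact [∀ a, Finite (B.obj.obj a)] (S : ShortComplex (ModuleCat.{w} k[Aut B]))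
    (hS : S.Exact) : (S.map (QFunctor k B)).Exact := by
  let T := S.map Rep.ofModuleMonoidAlgebra
  refine (FunRep.exact_iff _).2 fun a z hz => ?_
  have := Fintype.ofFinite (QRep.GenOrbit B a)
  have hcoeff (β : B.obj.obj a) : ∃ m : T.X₁, T.f.hom m = QRep.coeff T.X₂ β z :=
    (ShortComplex.moduleCat_exact_iff S).1 hS _ ((QRep.coeff_map_app T.g β z).symm.trans
      ((congrArg (QRep.coeff T.X₃ β) hz).trans (map_zero _)))
  choose m hm using hcoeff
  refine ⟨∑ o : QRep.GenOrbit B a, QRep.mk T.X₁ o.1.out (m o.1.out), (map_sum _ _ _).trans ?_⟩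
  refine Eq.trans (Finset.sum_congr rfl fun o _ => ?_) (QRep.sum_mk_coeff (V := T.X₂) z)
  exact (QRep.map_app_mk T.f _ _).trans (congrArg _ (hm _))

lemma preservesFiniteLimits_and_colimits_QFunctor [∀ a, Finite (B.obj.obj a)] :
    PreservesFiniteLimits (QFunctor k B) ∧ PreservesFiniteColimits (QFunctor k B) :=
  ((QFunctor k B).exact_tfae.out 1 3).1 QFunctor_map_exact

end Exact

variable [HasFiniteBiproducts 𝒜]

attribute [local instance] hasBinaryBiproducts_of_finite_biproducts

section Relations

variable {V : Rep.{w} k (Aut A)} {W : Rep.{w} k (Aut B)} [∀ a, Finite (B.obj.obj a)]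
  {a c : 𝒜} {β : B.obj.obj a}

/-- The coefficient of `(1, r) z` at `(1, r) β` is that of `z` at `β`, so that of `(1, 0) z` at
`(1, r) β` does not vanish either, and `(1, r) β` must be of the form `(1, 0) β'`. -/
lemma map_eq_zero_of_coeff_ne_zero {z : (QRep W).obj a} (hβ : IsGenerating β)
    (hz : QRep.coeff W β z ≠ 0) (r : a ⟶ c)
    (hr : (QRep W).map (biprod.lift (𝟙 a) r) z = (QRep W).map (biprod.lift (𝟙 a) 0) z) :
    B.obj.map r β = 0 := by
  classical
  have := Fintype.ofFinite (B.obj.obj a)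
  have map_fst (r : a ⟶ c) (y : B.obj.obj a) :
      B.obj.map biprod.fst (B.obj.map (biprod.lift (𝟙 a) r) y) = y := by
    rw [← Functor.map_comp_apply, biprod.lift_fst, Functor.map_id_apply]
  have map_snd (r : a ⟶ c) (y : B.obj.obj a) :
      B.obj.map biprod.snd (B.obj.map (biprod.lift (𝟙 a) r) y) = B.obj.map r y := by
    rw [← Functor.map_comp_apply, biprod.lift_snd]
  have hgen : IsGenerating (B.obj.map (biprod.lift (𝟙 a) r) β) :=
    .of_map biprod.fst (by rwa [map_fst])
  have hself : QRep.coeff W (B.obj.map (biprod.lift (𝟙 a) r) β)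
      ((QRep W).map (biprod.lift (𝟙 a) r) z) = QRep.coeff W β z := by
    rw [QRep.coeff_map _ hgen]
    refine Finset.sum_eq_single_of_mem β ((Finset.mem_filter_univ _).2 rfl) fun β' hβ' hne => ?_
    rw [Finset.mem_filter_univ] at hβ'
    exact absurd (by rw [← map_fst r β', hβ', map_fst]) hne
  rw [← hself, hr, QRep.coeff_map _ hgen] at hz
  obtain ⟨β', hβ', -⟩ := Finset.exists_ne_zero_of_sum_ne_zero hz
  rw [Finset.mem_filter_univ] at hβ'
  rw [← map_snd, ← hβ', map_snd, AddRep.map_zero_apply]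

lemma map_eq_zero_of_coeff_lin_ne_zero {X : 𝒜 ⥤ Type w} (hX : IsFiberAdditive X)
    (φ : lin k X ⟶ QRep W) {y : X.obj a} (hβ : IsGenerating β)
    (hz : QRep.coeff W β (φ.app a (pt k y)) ≠ 0) (r : a ⟶ c) (hr : X.map r y = X.map 0 y) :
    B.obj.map r β = 0 := by
  refine map_eq_zero_of_coeff_ne_zero hβ hz r ?_
  rw [← app_pt_naturality, ← app_pt_naturality]
  congr 2
  apply hX.ext
  · simp only [← Functor.map_comp_apply, biprod.lift_fst]
  · simp only [← Functor.map_comp_apply, biprod.lift_snd, hr]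

lemma map_eq_zero_of_coeff_hom_ne_zero (τ : QRep V ⟶ QRep W) {v : A.obj.obj a} {m : V}
    (hβ : IsGenerating β) (hz : QRep.coeff W β (τ.app a (QRep.mk V v m)) ≠ 0) (r : a ⟶ c)
    (hr : A.obj.map r v = 0) : B.obj.map r β = 0 := by
  refine map_eq_zero_of_coeff_ne_zero hβ hz r ?_
  have hlift : biprod.lift (𝟙 a) r = biprod.lift (𝟙 a) 0 + r ≫ biprod.inr := by
    apply biprod.hom_ext <;> simp
  rw [← NatTrans.naturality_apply, ← NatTrans.naturality_apply, QRep.map_mk, QRep.map_mk, hlift,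
    AddRep.map_add_apply, Functor.map_comp_apply, hr, map_zero, add_zero]

lemma QRep.hom_eq_zero (hB : IsFiniteObject B) (hAB : objLength A ≤ objLength B)
    (h : IsEmpty (A ≅ B)) (τ : QRep V ⟶ QRep W) : τ = 0 := by
  refine QRep.hom_ext fun a v m => QRep.ext_coeff fun β hβ => ?_
  change _ = coeff W β 0
  rw [map_zero]
  by_contra hz
  obtain ⟨φ, -⟩ := exists_iso_of_relations hB hAB (y := v) hβ fun c r hr =>
    map_eq_zero_of_coeff_hom_ne_zero τ hβ hz r hr
  exact h.false φ

end Relations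

section FullyFaithful

lemma faithful_QRepFunctor [IsNoetherianObject A] : (QRepFunctor k A).Faithful where
  map_injective {V W φ ψ} h := by
    obtain ⟨x, ξ, hξ⟩ := exists_isGenerating A
    ext m
    have hm := congr(QRep.coeff W ξ (NatTrans.app $h x (QRep.mk V ξ m)))
    rwa [QRep.map_app_mk, QRep.map_app_mk, QRep.coeff_mk_self hξ, QRep.coeff_mk_self hξ] at hm

variable [∀ a, Finite (B.obj.obj a)] {V W : Rep.{w} k (Aut B)}

lemma QRep.app_mk_eq_mk_coeff (hB : IsFiniteObject B) (τ : QRep V ⟶ QRep W) {x : 𝒜}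
    {ξ : B.obj.obj x} (hξ : IsGenerating ξ) (m : V) :
    τ.app x (mk V ξ m) = mk W ξ (coeff W ξ (τ.app x (mk V ξ m))) := by
  refine QRep.ext_coeff fun β hβ => ?_
  rw [coeff_mk]
  by_cases h : ∃ g : Aut B, g • ξ = β
  · obtain ⟨g, rfl⟩ := h
    rw [autCoeff_smul_self hξ, coeff_aut_smul]
  · rw [autCoeff_of_forall_ne (not_exists.1 h), LinearMap.zero_apply]
    by_contra hz
    exact h (exists_iso_of_relations hB le_rfl hβ fun c r hr =>
      map_eq_zero_of_coeff_hom_ne_zero τ hβ hz r hr)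

lemma full_QRepFunctor (hB : IsFiniteObject B) : (QRepFunctor k B).Full where
  map_surjective {V W} τ := by
    have := hB.isNoetherian
    obtain ⟨x, ξ, hξ⟩ := exists_isGenerating B
    let φ : V →ₗ[k] W := QRep.coeff W ξ ∘ₗ (τ.app x).hom ∘ₗ QRep.mk V ξ
    have hφ {a : 𝒜} (v : B.obj.obj a) (m : V) :
        τ.app a (QRep.mk V v m) = QRep.mk W v (φ m) := by
      obtain ⟨f, rfl⟩ := hξ v
      rw [← QRep.map_mk, NatTrans.naturality_apply, QRep.app_mk_eq_mk_coeff hB τ hξ, QRep.map_mk]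
      rfl
    have hφ_ρ (g : Aut B) (m : V) : φ (V.ρ g m) = W.ρ g (φ m) := by
      have h := hφ (g • ξ) (V.ρ g m)
      rw [QRep.mk_aut_smul, hφ, ← QRep.mk_aut_smul g] at h
      have h' := congrArg (QRep.coeff W (g • ξ)) h
      rwa [QRep.coeff_mk_self (hξ.aut_smul g), QRep.coeff_mk_self (hξ.aut_smul g), eq_comm] at h'
    exact ⟨Rep.ofHom { toLinearMap := φ, isIntertwining' := fun g => LinearMap.ext (hφ_ρ g) },
      QRep.hom_ext fun a v m => (QRep.map_app_mk _ v m).trans (hφ v m).symm⟩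

lemma faithful_QFunctor [IsNoetherianObject A] : (QFunctor k A).Faithful :=
  have := faithful_QRepFunctor (k := k) (A := A)
  inferInstanceAs (Rep.ofModuleMonoidAlgebra ⋙ QRepFunctor k A).Faithful

lemma full_QFunctor (hB : IsFiniteObject B) : (QFunctor k B).Full :=
  have := full_QRepFunctor (k := k) hB
  inferInstanceAs (Rep.ofModuleMonoidAlgebra ⋙ QRepFunctor k B).Full

end FullyFaithful

end QRepHom

/-! ### Elements which are not generating -/

section NonGenerating

variable {𝒜 : Type u} [Category.{v} 𝒜] [Preadditive 𝒜] {k : Type w} [Field k]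
  {A : AddRep.{w} 𝒜} {K : Type w}

/-- The disjoint union of copies of `A` indexed by `K`, as a functor to sets. -/
abbrev copies (A : AddRep.{w} 𝒜) (K : Type w) : 𝒜 ⥤ Type w where
  obj a := A.obj.obj a × K
  map f := ↾fun t => (A.obj.map f t.1, t.2)
  map_id _ := by
    ext t
    · exact A.obj.map_id_apply _ _
    · rfl
  map_comp f g := by
    ext t
    · exact A.obj.map_comp_apply f g _
    · rfl

/-- The elements of the copies of `A` which are not generating. -/
abbrev nongenerating (A : AddRep.{w} 𝒜) (K : Type w) : Subfunctor (copies A K) where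
  obj _ := {t | ¬ IsGenerating t.1}
  map f _ h h' := h (h'.of_map f)

/-- For each copy of `A`, the disjoint union of the subobjects of `A` consisting of the elements
sent by every morphism to `x` into a given subgroup of `A(x)` which does not contain `ξ`. -/
abbrev properCover {x : 𝒜} (ξ : A.obj.obj x) (K : Type w) :
    Subfunctor (copies A (K × {H : AddSubgroup (A.obj.obj x) // ξ ∉ H})) where
  obj a := {t | ∀ f : a ⟶ x, A.obj.map f t.1 ∈ t.2.2.1}
  map f t h g := by
    have := h (f ≫ g)
    rwa [Functor.map_comp_apply] at this

/-- The projection which forgets the subobjects. -/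
def properCover.π {x : 𝒜} (ξ : A.obj.obj x) (K : Type w) :
    (properCover ξ K).toFunctor ⟶ (nongenerating A K).toFunctor where
  app _ := ↾fun t => ⟨(t.1.1, t.1.2.1), fun h => by
    obtain ⟨f, hf⟩ := h ξ
    exact t.1.2.2.2 ((congrArg (· ∈ t.1.2.2.1) hf).mp (t.2 f))⟩
  naturality _ _ _ := rfl

lemma properCover.π_surjective {x : 𝒜} {ξ : A.obj.obj x} (hξ : IsGenerating ξ) (a : 𝒜) :
    Function.Surjective ((π ξ K).app a) := fun ⟨⟨v, i⟩, hv⟩ => by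
  refine ⟨⟨(v, i, ⟨(SubRep.span v).carrier x, fun h => hv fun b y => ?_⟩), fun f => ⟨f, rfl⟩⟩, rfl⟩
  obtain ⟨f, hf⟩ := (SubRep.mem_span v ξ).1 h
  obtain ⟨g, rfl⟩ := hξ y
  exact ⟨f ≫ g, by rw [Functor.map_comp_apply, hf]⟩

variable [HasFiniteBiproducts 𝒜]

attribute [local instance] hasBinaryBiproducts_of_finite_biproducts

lemma copies.isFiberAdditive (A : AddRep.{w} 𝒜) (K : Type w) : IsFiberAdditive (copies A K) where
  exists_lift {a c} t t' h := by
    obtain ⟨v, hv, hv'⟩ := A.exists_biprod_lift t.1 t'.1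
    have hi : t.2 = t'.2 := congrArg Prod.snd (h a)
    exact ⟨(v, t.2), Prod.ext hv rfl, Prod.ext hv' hi⟩
  ext {a c} t t' h h' := by
    have hfst : A.obj.map biprod.fst t.1 = A.obj.map biprod.fst t'.1 := congrArg Prod.fst h
    have hsnd : A.obj.map biprod.snd t.1 = A.obj.map biprod.snd t'.1 := congrArg Prod.fst h'
    have hi : t.2 = t'.2 := congrArg (Prod.snd (α := A.obj.obj a)) h
    refine Prod.ext ?_ hi
    rw [← A.biprod_total_apply t.1, ← A.biprod_total_apply t'.1, hfst, hsnd]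

lemma IsFiberAdditive.subfunctor_ext {X : 𝒜 ⥤ Type w} (hX : IsFiberAdditive X) (S : Subfunctor X)
    {a c : 𝒜} {t t' : S.toFunctor.obj (a ⊞ c)}
    (h : S.toFunctor.map biprod.fst t = S.toFunctor.map biprod.fst t')
    (h' : S.toFunctor.map biprod.snd t = S.toFunctor.map biprod.snd t') : t = t' :=
  Subtype.ext (hX.ext (congrArg Subtype.val h) (congrArg Subtype.val h'))

lemma IsFiberAdditive.subfunctor {X : 𝒜 ⥤ Type w} (hX : IsFiberAdditive X) (S : Subfunctor X)
    (hS : ∀ {a c : 𝒜} (t : X.obj (a ⊞ c)), X.map biprod.fst t ∈ S.obj a →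
      X.map biprod.snd t ∈ S.obj c → t ∈ S.obj (a ⊞ c)) : IsFiberAdditive S.toFunctor where
  exists_lift {a c} t t' h := by
    obtain ⟨y, hy, hy'⟩ := hX.exists_lift t.1 t'.1 fun e => congrArg Subtype.val (h e)
    exact ⟨⟨y, hS y (hy ▸ t.2) (hy' ▸ t'.2)⟩, Subtype.ext hy, Subtype.ext hy'⟩
  ext := hX.subfunctor_ext S

lemma properCover.isFiberAdditive {x : 𝒜} (ξ : A.obj.obj x) (K : Type w) :
    IsFiberAdditive (properCover ξ K).toFunctor :=
  (copies.isFiberAdditive A _).subfunctor _ fun t h h' f => by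
    have hl : A.obj.map (biprod.inl ≫ f) (A.obj.map biprod.fst t.1) ∈ t.2.2.1 := h _
    have hr : A.obj.map (biprod.inr ≫ f) (A.obj.map biprod.snd t.1) ∈ t.2.2.1 := h' _
    rw [← A.biprod_total_apply t.1, map_add]
    simpa only [Functor.map_comp_apply] using add_mem hl hr

lemma properCover.isFiberAdditive_cech {x : 𝒜} (ξ : A.obj.obj x) (K : Type w) (p : ℕ) :
    IsFiberAdditive (cech (π ξ K) (p + 1)) :=
  (isFiberAdditive ξ K).cech_succ ((copies.isFiberAdditive A K).subfunctor_ext _) _ p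

section Ext

universe t

open Abelian
open scoped MonoidAlgebra

variable {B : AddRep.{w} 𝒜} [∀ a, Finite (B.obj.obj a)] (hB : IsFiniteObject B)
  (hAB : objLength A ≤ objLength B)

include hB hAB

lemma lin_cech_properCover_hom_eq_zero {x : 𝒜} (ξ : A.obj.obj x) {W : Rep.{w} k (Aut B)} {p : ℕ}
    (φ : lin k (cech (properCover.π ξ K) (p + 1)) ⟶ QRep W) : φ = 0 := by
  refine lin_hom_ext fun a (y : FiberPower _ _ a) => QRep.ext_coeff fun β hβ => ?_
  change _ = QRep.coeff W β 0
  rw [map_zero]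
  by_contra hz
  obtain ⟨ψ, hψ⟩ := exists_iso_of_relations hB hAB (y := y.base.1.1) hβ fun c r hr =>
    map_eq_zero_of_coeff_lin_ne_zero (properCover.isFiberAdditive_cech ξ K p) φ hβ hz r <| by
      have hr' : A.obj.map r y.base.1.1 = A.obj.map 0 y.base.1.1 := by
        rw [hr, AddRep.map_zero_apply]
      have hy (i : Fin (p + 1)) : (y.comp i).1.1 = y.base.1.1 :=
        congrArg (fun t => t.1.1) (y.π_comp i)
      refine FiberPower.ext (Subtype.ext (Prod.ext hr' rfl)) (funext fun i =>
        Subtype.ext (Prod.ext ?_ rfl))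
      exact (congrArg _ (hy i)).trans (hr'.trans (congrArg _ (hy i).symm))
  exact y.base.2 (.of_iso ψ (hψ ▸ hβ))

variable [EssentiallySmall.{w} 𝒜] [HasExt.{t} (FunRep k 𝒜)] [Small.{w} k[Aut B]]
  (J : ModuleCat.{w} k[Aut B]) [Injective J]

theorem subsingleton_ext_lin_nongenerating [IsNoetherianObject A] (n : ℕ) :
    Subsingleton (Ext (lin k (nongenerating A K).toFunctor) ((QFunctor k B).obj J) n) := by
  obtain ⟨x, ξ, hξ⟩ := exists_isGenerating A
  have hπ := properCover.π_surjective (K := K) hξ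
  cases n with
  | zero =>
    have := cech.epi_d_zero (k := k) hπ
    let e := Functor.isoWhiskerRight (cech.zeroIso (properCover.π ξ K)) (ModuleCat.free k)
    refine (subsingleton_ext_zero_iff _ _).2 fun φ => ?_
    rw [← cancel_epi e.hom, ← cancel_epi (cech.d k (properCover.π ξ K) 0), comp_zero, comp_zero]
    exact lin_cech_properCover_hom_eq_zero hB hAB ξ _
  | succ n =>
    refine subsingleton_ext_lin_of_cech hπ n (fun p φ _ => ⟨0, ?_⟩) fun p i _ =>
      subsingleton_ext_lin_QFunctor (properCover.isFiberAdditive_cech ξ K p) J i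
    exact comp_zero.trans (lin_cech_properCover_hom_eq_zero hB hAB ξ φ).symm

end Ext

end NonGenerating

/-! ### Free modules -/

section Free

open scoped MonoidAlgebra

variable {𝒜 : Type u} [Category.{v} 𝒜] {k : Type w} [Field k]

/-- The basis of `k[X(a)]` given by the elements of `X(a)`. -/
def linBasis (k : Type w) [Field k] (X : 𝒜 ⥤ Type w) (a : 𝒜) :
    Module.Basis (X.obj a) k ((lin k X).obj a) :=
  Finsupp.basisSingleOne

/-- The inclusion `k[S] ⟶ k[X]` for a subfunctor `S` of `X`. -/
abbrev linι (k : Type w) [Field k] {X : 𝒜 ⥤ Type w} (S : Subfunctor X) :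
    lin k S.toFunctor ⟶ lin k X :=
  Functor.whiskerRight S.ι (ModuleCat.free k)

variable {X : 𝒜 ⥤ Type w} (S : Subfunctor X)

lemma linι_pt {a : 𝒜} (t : S.toFunctor.obj a) :
    (linι k S).app a (pt k t) = pt k (X := X) t.1 :=
  ModuleCat.free_map_apply _ _

lemma mono_linι : Mono (linι k S) :=
  (FunRep.mono_iff _).2 fun _ => Finsupp.mapDomain_injective Subtype.val_injective

lemma exists_linι_eq {a : 𝒜} {z : (lin k X).obj a}
    (hz : ∀ t ∉ S.obj a, (linBasis k X a).repr z t = 0) : ∃ y, (linι k S).app a y = z := by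
  have hmem : z ∈ Submodule.span k (linBasis k X a '' S.obj a) :=
    (Module.Basis.mem_span_image _).2 fun t ht => by
      by_contra h
      exact Finsupp.mem_support_iff.1 ht (hz t h)
  have hle : Submodule.span k (linBasis k X a '' S.obj a) ≤
      LinearMap.range ((linι k S).app a).hom := by
    refine Submodule.span_le.2 ?_
    rintro _ ⟨t, ht, rfl⟩
    exact ⟨pt k (X := S.toFunctor) ⟨t, ht⟩, linι_pt S _⟩
  exact hle hmem

/-- The `k`-basis consisting of the translates of the elements of a `k[G]`-basis. -/
def translatesBasis {G I : Type*} [Group G] {L : ModuleCat.{w} k[G]}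
    (b : Module.Basis I k[G] L) : Module.Basis (G × I) k (Rep.ofModuleMonoidAlgebra.obj L) :=
  let : Module k[G] (RestrictScalars k k[G] L) := RestrictScalars.moduleOrig k k[G] L
  (MonoidAlgebra.basis G k).smulTower (A := RestrictScalars k k[G] L) b

lemma translatesBasis_apply {G I : Type*} [Group G] {L : ModuleCat.{w} k[G]}
    (b : Module.Basis I k[G] L) (g h : G) (i : I) :
    (Rep.ofModuleMonoidAlgebra.obj L).ρ g (translatesBasis b (h, i)) =
      translatesBasis b (g * h, i) := by
  have hb (g : G) : translatesBasis b (g, i) = (MonoidAlgebra.single g (1 : k) • b i : L) :=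
    let : Module k[G] (RestrictScalars k k[G] L) := RestrictScalars.moduleOrig k k[G] L
    Module.Basis.smulTower_apply (A := RestrictScalars k k[G] L) _ _ _
  rw [hb, hb]
  change (MonoidAlgebra.single g (1 : k) • MonoidAlgebra.single h (1 : k) • b i : L) = _
  rw [smul_smul, MonoidAlgebra.single_mul_single, one_mul]

variable [Preadditive 𝒜] {A : AddRep.{w} 𝒜} {L : ModuleCat.{w} k[Aut A]} {I : Type w}
  (b : Module.Basis I k[Aut A] L)

/-- The morphism from the linearisation of copies of `A` to `Q_{A, L}` given by a basis of `L`. -/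
def freeDesc : lin k (copies A I) ⟶ (QFunctor k A).obj L :=
  linDesc (F := QRep (Rep.ofModuleMonoidAlgebra.obj L))
    (fun _ t => QRep.mk _ t.1 (translatesBasis b (1, t.2))) fun f t => (QRep.map_mk f t.1 _).symm

lemma freeDesc_pt {a : 𝒜} (t : (copies A I).obj a) :
    (freeDesc b).app a (pt k t) = QRep.mk _ t.1 (translatesBasis b (1, t.2)) :=
  ModuleCat.freeDesc_apply _ _

lemma linι_nongenerating_freeDesc : linι k (nongenerating A I) ≫ freeDesc b = 0 :=
  lin_hom_ext fun a t => by
    rw [NatTrans.comp_app_apply, linι_pt, freeDesc_pt]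
    exact QRep.mk_eq_zero t.2 _

lemma epi_freeDesc : Epi (freeDesc b) := by
  refine (FunRep.epi_iff _).2 fun a z => ?_
  change z ∈ LinearMap.range ((freeDesc b).app a).hom
  induction z using QRep.induction with
  | zero => exact zero_mem _
  | add x y hx hy => exact add_mem hx hy
  | mk v m _ =>
    suffices h : ⊤ ≤ (LinearMap.range ((freeDesc b).app a).hom).comap (QRep.mk _ v) from
      h (Submodule.mem_top (x := m))
    rw [← (translatesBasis b).span_eq, Submodule.span_le]
    rintro _ ⟨⟨g, i⟩, rfl⟩
    refine ⟨pt k (X := copies A I) (g⁻¹ • v, i), (freeDesc_pt b _).trans ?_⟩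
    rw [← QRep.mk_aut_smul g, smul_inv_smul, translatesBasis_apply, mul_one]

lemma translatesBasis_repr_coeff_freeDesc {a : 𝒜} {β : A.obj.obj a} (hβ : IsGenerating β) (i : I)
    (z : (lin k (copies A I)).obj a) :
    (translatesBasis b).repr (QRep.coeff _ β ((freeDesc b).app a z)) (1, i) =
      (linBasis k (copies A I) a).repr z (β, i) := by
  classical
  suffices h : (translatesBasis b).coord (1, i) ∘ₗ QRep.coeff _ β ∘ₗ ((freeDesc b).app a).hom =
      (linBasis k (copies A I) a).coord (β, i) from LinearMap.congr_fun h z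
  refine (linBasis k (copies A I) a).ext fun ⟨v, j⟩ => ?_
  change (translatesBasis b).repr (QRep.coeff _ β ((freeDesc b).app a (pt k (v, j)))) (1, i) =
    (linBasis k (copies A I) a).repr (linBasis k (copies A I) a (v, j)) (β, i)
  rw [freeDesc_pt, QRep.coeff_mk, Module.Basis.repr_self_apply]
  by_cases h : ∃ g : Aut A, g • v = β
  · obtain ⟨g, rfl⟩ := h
    have hg : g = 1 ↔ v = g • v := ⟨fun h => by rw [h, one_smul],
      fun h => hβ.of_aut_smul.aut_smul_injective (h.symm.trans (one_smul _ _).symm)⟩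
    rw [QRep.autCoeff_smul_self hβ.of_aut_smul, translatesBasis_apply,
      Module.Basis.repr_self_apply, mul_one]
    simp only [Prod.mk.injEq, hg]
  · rw [QRep.autCoeff_of_forall_ne (not_exists.1 h), LinearMap.zero_apply, map_zero, if_neg]
    · rfl
    · exact fun h' => h ⟨1, (one_smul _ _).trans (congrArg Prod.fst h')⟩

lemma shortExact_freeDesc :
    (ShortComplex.mk _ _ (linι_nongenerating_freeDesc b)).ShortExact where
  exact := (FunRep.exact_iff _).2 fun a z hz => by
    refine exists_linι_eq _ fun t ht => ?_
    rw [← translatesBasis_repr_coeff_freeDesc b (not_not.1 ht)]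
    have h0 : QRep.coeff _ t.1 ((freeDesc b).app a z) = 0 := (congrArg _ hz).trans (map_zero _)
    rw [h0, map_zero, Finsupp.zero_apply]
  mono_f := mono_linι _
  epi_g := epi_freeDesc b

section Ext

universe t

open Abelian

attribute [local instance] hasBinaryBiproducts_of_finite_biproducts

variable [HasFiniteBiproducts 𝒜] [EssentiallySmall.{w} 𝒜] [HasExt.{t} (FunRep k 𝒜)]
  {B : AddRep.{w} 𝒜} [∀ a, Finite (B.obj.obj a)] [Small.{w} k[Aut B]]

include b in
lemma subsingleton_ext_QFunctor_of_basis [IsNoetherianObject A] (hB : IsFiniteObject B)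
    (hAB : objLength A ≤ objLength B) (J : ModuleCat.{w} k[Aut B]) [Injective J] (n : ℕ) :
    Subsingleton (Ext ((QFunctor k A).obj L) ((QFunctor k B).obj J) (n + 1)) :=
  subsingleton_ext_X₃ (shortExact_freeDesc b)
    (subsingleton_ext_lin_nongenerating hB hAB J n)
    (subsingleton_ext_lin_QFunctor (copies.isFiberAdditive A I) J n)

end Ext

end Free

/-! ### Extensions between the functors `Q_{A, M}` -/

section Main

universe t t'

open Abelian
open scoped MonoidAlgebra

lemma exists_epi_of_basis {R : Type*} [Ring R] [Small.{w} R] (M : ModuleCat.{w} R) :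
    ∃ (L : ModuleCat.{w} R) (_ : Module.Basis M R L) (f : L ⟶ M), Epi f := by
  let b : Module.Basis M R (M →₀ Shrink.{w} R) :=
    ⟨Finsupp.mapRange.linearEquiv (Shrink.linearEquiv R R)⟩
  refine ⟨ModuleCat.of R (M →₀ Shrink.{w} R), b, ModuleCat.ofHom (b.constr ℕ id), ?_⟩
  rw [ModuleCat.epi_iff_surjective]
  exact fun m => ⟨b m, b.constr_basis ℕ id m⟩

variable {𝒜 : Type u} [Category.{v} 𝒜] [Preadditive 𝒜] [HasFiniteBiproducts 𝒜]
  {k : Type w} [Field k] {A B : AddRep.{w} 𝒜}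

lemma IsFiniteObject.finite_obj [∀ x y : 𝒜, Finite (x ⟶ y)] (hA : IsFiniteObject A) (a : 𝒜) :
    Finite (A.obj.obj a) := by
  have := hA.isNoetherian
  obtain ⟨x, ξ, hξ⟩ := exists_isGenerating A
  exact hξ.finite

lemma small_monoidAlgebra_aut [IsNoetherianObject A] : Small.{w} k[Aut A] := by
  obtain ⟨x, ξ, hξ⟩ := exists_isGenerating A
  have : Small.{w} (Aut A) := small_of_injective hξ.aut_smul_injective
  exact small_of_injective (MonoidAlgebra.coeffEquiv (R := k) (M := Aut A)).injective

variable [EssentiallySmall.{w} 𝒜] [HasExt.{t} (FunRep k 𝒜)] [∀ a, Finite (A.obj.obj a)]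

lemma subsingleton_ext_QFunctor_succ [∀ a, Finite (B.obj.obj a)] [IsNoetherianObject A]
    (hB : IsFiniteObject B) (hAB : objLength A ≤ objLength B) {J : ModuleCat.{w} k[Aut B]}
    [Injective J] {n : ℕ}
    (h : ∀ M, Subsingleton (Ext ((QFunctor k A).obj M) ((QFunctor k B).obj J) n))
    (M : ModuleCat.{w} k[Aut A]) :
    Subsingleton (Ext ((QFunctor k A).obj M) ((QFunctor k B).obj J) (n + 1)) := by
  have := hB.isNoetherian
  have := small_monoidAlgebra_aut (k := k) (A := A)
  have := small_monoidAlgebra_aut (k := k) (A := B)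
  obtain ⟨_, _⟩ := preservesFiniteLimits_and_colimits_QFunctor (k := k) (B := A)
  obtain ⟨L, b, f, hf⟩ := exists_epi_of_basis M
  exact subsingleton_ext_X₃ ((shortExact_kernel f).map_of_exact (QFunctor k A)) (h _)
    (subsingleton_ext_QFunctor_of_basis b hB hAB J n)

theorem subsingleton_ext_QFunctor_of_isEmpty_iso [∀ a, Finite (B.obj.obj a)]
    (hA : IsFiniteObject A) (hB : IsFiniteObject B) (hAB : objLength A ≤ objLength B)
    (hiso : IsEmpty (A ≅ B)) (M : ModuleCat.{w} k[Aut A]) (N : ModuleCat.{w} k[Aut B]) (n : ℕ) :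
    Subsingleton (Ext ((QFunctor k A).obj M) ((QFunctor k B).obj N) n) := by
  have := hA.isNoetherian
  have := hB.isNoetherian
  have := small_monoidAlgebra_aut (k := k) (A := B)
  obtain ⟨_, _⟩ := preservesFiniteLimits_and_colimits_QFunctor (k := k) (B := B)
  induction n generalizing M N with
  | zero => exact (subsingleton_ext_zero_iff _ _).2 (QRep.hom_eq_zero hB hAB hiso)
  | succ n ih =>
    let P : InjectivePresentation N := Classical.arbitrary _
    have := P.injective
    exact subsingleton_ext_X₁_right ((shortExact_cokernel P.f).map_of_exact (QFunctor k B))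
      (ih _ _) (subsingleton_ext_QFunctor_succ hB hAB (fun M' => ih M' _) M)

theorem subsingleton_ext_QFunctor_of_injective (hA : IsFiniteObject A)
    (M J : ModuleCat.{w} k[Aut A]) [Injective J] (n : ℕ) :
    Subsingleton (Ext ((QFunctor k A).obj M) ((QFunctor k A).obj J) (n + 1)) := by
  have := hA.isNoetherian
  induction n generalizing M with
  | zero =>
    have := small_monoidAlgebra_aut (k := k) (A := A)
    obtain ⟨_, _⟩ := preservesFiniteLimits_and_colimits_QFunctor (k := k) (B := A)
    have := full_QFunctor (k := k) hA
    obtain ⟨L, b, f, hf⟩ := exists_epi_of_basis M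
    refine subsingleton_ext_one_X₃ ((shortExact_kernel f).map_of_exact (QFunctor k A))
      (fun ψ => ?_) (subsingleton_ext_QFunctor_of_basis b hA le_rfl J 0)
    obtain ⟨ψ, rfl⟩ := (QFunctor k A).map_surjective ψ
    refine ⟨(QFunctor k A).map (Injective.factorThru ψ (kernel.ι f)), ?_⟩
    exact ((QFunctor k A).map_comp _ _).symm.trans
      (congrArg _ (Injective.comp_factorThru ψ (kernel.ι f)))
  | succ n ih => exact subsingleton_ext_QFunctor_succ hA le_rfl ih M

theorem QFunctor_mapExtAddHom_bijective (hA : IsFiniteObject A)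
    [HasExt.{t'} (ModuleCat.{w} k[Aut A])] [PreservesFiniteLimits (QFunctor k A)]
    [PreservesFiniteColimits (QFunctor k A)] (M N : ModuleCat.{w} k[Aut A]) (n : ℕ) :
    Function.Bijective ((QFunctor k A).mapExtAddHom M N n) := by
  have := hA.isNoetherian
  have := small_monoidAlgebra_aut (k := k) (A := A)
  have := full_QFunctor (k := k) hA
  have := faithful_QFunctor (k := k) (A := A)
  exact mapExtAddHom_bijective_of_acyclic_injective _ M
    (fun J _ n => subsingleton_ext_QFunctor_of_injective hA M J n) N n

end Main

end GenericRep

end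

open CategoryTheory CategoryTheory.Limits GenericRep in
open scoped MonoidAlgebra in
theorem mainTheorem9_general (k : Type w) [Field k]
    (𝒜 : Type u) [Category.{v} 𝒜] [Preadditive 𝒜] [HasFiniteBiproducts 𝒜]
    [EssentiallySmall.{w} 𝒜] :
    (∀ A B : AddRep.{w} 𝒜, (∀ a, Finite (A.obj.obj a)) → (∀ a, Finite (B.obj.obj a)) →
      IsFiniteObject A → IsFiniteObject B → objLength A ≤ objLength B → IsEmpty (A ≅ B) →
      ∀ (M : ModuleCat.{w} k[Aut A]) (N : ModuleCat.{w} k[Aut B]) (n : ℕ),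
        Subsingleton (ExtGroup ((QFunctor k A).obj M) ((QFunctor k B).obj N) n)) ∧
    (∀ A : AddRep.{w} 𝒜, (∀ a, Finite (A.obj.obj a)) → IsFiniteObject A →
      ∃ (_ : PreservesFiniteLimits (QFunctor k A)) (_ : PreservesFiniteColimits (QFunctor k A)),
      ∀ (M N : ModuleCat.{w} k[Aut A]) (n : ℕ),
        Function.Bijective (mapExtGroup (QFunctor k A) M N n)) := by
  let : HasExt.{max (max (w + 1) v u) w v u} (FunRep.{w} k 𝒜) := HasExt.standard _
  refine ⟨fun A B _ _ hA hB hAB hiso =>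
    subsingleton_ext_QFunctor_of_isEmpty_iso hA hB hAB hiso, fun A _ hA => ?_⟩
  obtain ⟨h₁, h₂⟩ := preservesFiniteLimits_and_colimits_QFunctor (k := k) (B := A)
  let : HasExt.{_} (ModuleCat.{w} k[Aut A]) := HasExt.standard _
  exact ⟨h₁, h₂, QFunctor_mapExtAddHom_bijective hA⟩

open CategoryTheory CategoryTheory.Limits GenericRep in
open scoped MonoidAlgebra in
theorem mainTheorem9 (k : Type w) [Field k]
    (𝒜 : Type u) [Category.{v} 𝒜] [Preadditive 𝒜] [HasFiniteBiproducts 𝒜]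
    [EssentiallySmall.{w} 𝒜] (h𝒜 : IsKTrivial k 𝒜) :
    (∀ A B : AddRep.{w} 𝒜, IsFiniteObject A → IsFiniteObject B →
      objLength A ≤ objLength B → IsEmpty (A ≅ B) →
      ∀ (M : ModuleCat.{w} k[Aut A]) (N : ModuleCat.{w} k[Aut B]) (n : ℕ),
        Subsingleton (ExtGroup ((QFunctor k A).obj M) ((QFunctor k B).obj N) n)) ∧
    (∀ A : AddRep.{w} 𝒜, IsFiniteObject A →
      ∃ (_ : PreservesFiniteLimits (QFunctor k A)) (_ : PreservesFiniteColimits (QFunctor k A)),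
      ∀ (M N : ModuleCat.{w} k[Aut A]) (n : ℕ),
        Function.Bijective (mapExtGroup (QFunctor k A) M N n)) := by
  have := h𝒜.finite_hom
  exact ⟨fun A B hA hB => (mainTheorem9_general k 𝒜).1 A B hA.finite_obj hB.finite_obj hA hB,
    fun A hA => (mainTheorem9_general k 𝒜).2 A hA.finite_obj hA⟩
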